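/- All spaces are complex Banach spaces. A Banach space $Y$ has cotype $q$ if there is a constant $C>0$ such that $\big(\sum_{k=1}^N\|x_k\|^q\big)^{1/q}\le C\big(\int_0^1\|\sum_{k=1}^N r_k(t)x_k\|^2\,dt\big)^{1/2}$ for all finite families $x_1,\dots,x_N\in Y$, where $r_k$ are the Rademacher functions (for $q=\infty$ the left-hand side is $\max_k\|x_k\|$). A bounded linear operator $v:X\to Y$ is $(r,1)$-summing if there is a constant $C>0$ such that $\big(\sum_{k=1}^N\|v x_k\|^r\big)^{1/r}\le C\sup_{\|x^*\|\le 1}\sum_{k=1}^N|x^*(x_k)|$ for all finite families $x_1,\dots,x_N\in X$, the supremum being over $x^*\in X^*$. **Theorem.** Let $Y$ have cotype $q$ and let $v:X\to Y$ be $(r,1)$-summing, where $1\le r\le q\le\infty$. Let $m\ge 1$ and $1\le p_1,\dots,p_m\le\infty$ satisfy $\frac1{p_1}+\dots+\frac1{p_m}<\frac1r$, and define $\lambda,\mu\in(0,\infty)$ by $$\frac1\lambda=\frac1r-\Big(\frac1{p_1}+\dots+\frac1{p_m}\Big),\qquad \frac1\mu=\frac1{m\lambda}+\frac{m-1}{mq}$$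 (with $1/\infty=0$). Then there is a constant $C>0$ such that every continuous $m$-linear mapping $T:\ell_{p_1}\times\dots\times\ell_{p_m}\to X$, with coefficients $a_{i_1,\dots,i_m}=T(e_{i_1},\dots,e_{i_m})$, where $e_i$ are the canonical unit vectors, satisfies: 1. if $\lambda\ge q$, then $\Big(\sum_{i_1,\dots,i_m=1}^\infty\|v\,a_{i_1,\dots,i_m}\|^\lambda\Big)^{1/\lambda}\le C\|T\|$; 2. if $\lambda<q$, then $\Big(\sum_{i_1,\dots,i_m=1}^\infty\|v\,a_{i_1,\dots,i_m}\|^\mu\Big)^{1/\mu}\le C\|T\|$. Here $\|T\|=\sup\{\|T(x_1,\dots,x_m)\|:\|x_j\|\le1,\ j=1,\dots,m\}$. -/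

import Mathlib

open scoped ENNReal

/-- The Rademacher function `r_k(t) = sign (sin (2 ^ k π t))`; the usual sequence is `r₁, r₂, …`. -/
noncomputable def rademacher (k : ℕ) (t : ℝ) : ℝ :=
  Real.sign (Real.sin (2 ^ k * Real.pi * t))

/-- The `ℓ_s` norm of a finite family of vectors: `(∑ k, ‖x k‖ ^ s) ^ (1 / s)` for `s < ∞`, and
`max_k ‖x k‖` for `s = ∞` (used for `1 ≤ s ≤ ∞`). -/
noncomputable def finNorm {E : Type*} [NormedAddCommGroup E] (s : ℝ≥0∞) {N : ℕ}
    (x : Fin N → E) : ℝ :=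
  ‖(WithLp.toLp s x : PiLp s (fun _ : Fin N => E))‖

/-- `Y` has cotype `q`: for some constant `C` and every finite family `x₁, …, x_N` of `Y`,
`(∑ ‖x_k‖ ^ q) ^ (1 / q) ≤ C (∫₀¹ ‖∑ r_k(t) x_k‖² dt) ^ (1 / 2)`. -/
def HasCotype (Y : Type*) [NormedAddCommGroup Y] [NormedSpace ℂ Y] (q : ℝ≥0∞) : Prop :=
  ∃ C : ℝ, 0 < C ∧ ∀ (N : ℕ) (x : Fin N → Y),
    finNorm q x ≤
      C * Real.sqrt (∫ t in (0 : ℝ)..1,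
        ‖∑ k : Fin N, ((rademacher (k.val + 1) t : ℝ) : ℂ) • x k‖ ^ 2)

/-- `v : X → Y` is `(r, s)`-summing: for some constant `C` and every finite family `x₁, …, x_N`
of `X`, `(∑ ‖v x_k‖ ^ r) ^ (1 / r) ≤ C sup_{‖φ‖ ≤ 1} (∑ |φ x_k| ^ s) ^ (1 / s)`, the supremum
running over the unit ball of the dual of `X`. -/
def IsSumming {X Y : Type*} [NormedAddCommGroup X] [NormedSpace ℂ X]
    [NormedAddCommGroup Y] [NormedSpace ℂ Y] (r s : ℝ≥0∞) (v : X →L[ℂ] Y) : Prop :=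
  ∃ C : ℝ, 0 < C ∧ ∀ (N : ℕ) (x : Fin N → X),
    finNorm r (fun k => v (x k)) ≤
      C * ⨆ φ : Metric.closedBall (0 : X →L[ℂ] ℂ) 1, finNorm s (fun k => φ.1 (x k))

/-- The complex sequence space `ℓ_p`, `1 ≤ p ≤ ∞`. -/
abbrev SeqSpace (p : ℝ≥0∞) : Type := lp (fun _ : ℕ => ℂ) p

/-- The coefficient `a_{i₁ … i_m} = T (e_{i₁}, …, e_{i_m})` of an `m`-linear mapping
`T : ℓ_{p₁} × ⋯ × ℓ_{p_m} → X`. -/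
noncomputable def coefficient {X : Type*} [NormedAddCommGroup X] [NormedSpace ℂ X] {m : ℕ}
    {p : Fin m → ℝ≥0∞} [∀ j, Fact (1 ≤ p j)]
    (T : ContinuousMultilinearMap ℂ (fun j => SeqSpace (p j)) X) (i : Fin m → ℕ) : X :=
  T (fun j => lp.single (p j) (i j) (1 : ℂ))

/-! Put weights `z_j ^ (1 / p_j)` on the j-th index, with `z_j` nonnegative of total mass at most
one. Sequences dominated by such weights lie in the unit ball of `ℓ_{p_j}`. Hence, for any choice of
signs, the slices of the weighted coefficients along coordinate k have weak ℓ₁-norm at most `‖T‖`,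
and `v` sends them to an `r`-summable family. Averaging over signs and iterating the cotype
inequality bounds the mixed `(r, q)`-norms of the weighted `‖v a_i‖`, for every k and all weights at
once (`weighted_mixed_le`).

The weights are then removed by testing on the array itself. Let `R_j(a)` be the sum of `‖v a_i‖ ^
q` over `i_j = a`, and take `z_j` to be `R_j ^ (λ / q)`, normalised by the largest of the m total
masses. Two applications of Hölder turn the weighted bound into a bound for that largest mass
(`one_le_of_fiberSum_normalized`), so all unweighted mixed `(λ, q)`-norms are controlled. Blei's
inequality (`sum_rpow_le_one_of_fiberSum`) passes to `ℓ_μ`.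

This needs `λ < q < ∞`. If `q ≤ λ`, cotype `q` gives every larger exponent; letting that exponent
decrease to `λ` makes `μ` tend to `λ`. If `q = ∞`, the exponent tends to infinity on finitely many
coefficients. -/

open scoped BigOperators

/-! ### Hölder's inequality for several families. -/

/-- Hölder's inequality for finitely many families with weights summing to `1`. -/
theorem Real.sum_prod_rpow_le {ι κ : Type*} (s : Finset ι) (t : Finset κ) (f : κ → ι → ℝ)
    (w : κ → ℝ) (hf : ∀ j ∈ t, ∀ i ∈ s, 0 ≤ f j i) (hw : ∀ j ∈ t, 0 ≤ w j)
    (hw1 : ∑ j ∈ t, w j = 1) :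
    ∑ i ∈ s, ∏ j ∈ t, f j i ^ w j ≤ ∏ j ∈ t, (∑ i ∈ s, f j i) ^ w j := by
  have hF : ∀ j ∈ t, 0 ≤ ∑ i ∈ s, f j i := fun j hj => Finset.sum_nonneg (hf j hj)
  have key : ∀ i ∈ s, ∏ j ∈ t, f j i ^ w j ≤
      (∏ j ∈ t, (∑ i ∈ s, f j i) ^ w j) * ∑ j ∈ t, w j * (f j i / ∑ i ∈ s, f j i) := by
    intro i hi
    have h1 : ∏ j ∈ t, f j i ^ w j =
        (∏ j ∈ t, (∑ i ∈ s, f j i) ^ w j) * ∏ j ∈ t, (f j i / ∑ i ∈ s, f j i) ^ w j := by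
      rw [← Finset.prod_mul_distrib]
      refine Finset.prod_congr rfl fun j hj => ?_
      rw [← Real.mul_rpow (hF j hj) (div_nonneg (hf j hj i hi) (hF j hj))]
      by_cases h0 : ∑ i ∈ s, f j i = 0
      · rw [(Finset.sum_eq_zero_iff_of_nonneg (hf j hj)).1 h0 i hi, h0, zero_mul]
      · rw [mul_div_cancel₀ _ h0]
    rw [h1]
    refine mul_le_mul_of_nonneg_left ?_
      (Finset.prod_nonneg fun j hj => Real.rpow_nonneg (hF j hj) _)
    exact Real.geom_mean_le_arith_mean_weighted t w _ hw hw1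
      fun j hj => div_nonneg (hf j hj i hi) (hF j hj)
  refine (Finset.sum_le_sum key).trans ?_
  rw [← Finset.mul_sum, Finset.sum_comm]
  refine mul_le_of_le_one_right
    (Finset.prod_nonneg fun j hj => Real.rpow_nonneg (hF j hj) _) ?_
  rw [← hw1]
  refine Finset.sum_le_sum fun j hj => ?_
  rw [← Finset.mul_sum, ← Finset.sum_div]
  exact mul_le_of_le_one_right (hw j hj) (div_self_le_one _)

theorem Real.sum_rpow_mul_prod_rpow_le {ι κ : Type*} (s : Finset ι) (t : Finset κ) (g : ι → ℝ)
    (f : κ → ι → ℝ) (a : ℝ) (w : κ → ℝ) (hg : ∀ i ∈ s, 0 ≤ g i)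
    (hf : ∀ j ∈ t, ∀ i ∈ s, 0 ≤ f j i) (ha : 0 ≤ a) (hw : ∀ j ∈ t, 0 ≤ w j)
    (hw1 : a + ∑ j ∈ t, w j = 1) :
    ∑ i ∈ s, g i ^ a * ∏ j ∈ t, f j i ^ w j ≤
      (∑ i ∈ s, g i) ^ a * ∏ j ∈ t, (∑ i ∈ s, f j i) ^ w j := by
  have := Real.sum_prod_rpow_le s (Finset.insertNone t) (fun o => o.elim g f)
    (fun o => o.elim a w)
    (by
      intro j hj
      cases j with
      | none => simpa using hg
      | some j => exact hf j (Finset.some_mem_insertNone.1 hj))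
    (by
      intro j hj
      cases j with
      | none => simpa using ha
      | some j => exact hw j (Finset.some_mem_insertNone.1 hj))
    (by simpa [Finset.sum_insertNone] using hw1)
  simpa [Finset.prod_insertNone] using this

/-! ### Mixed norms: removing the weights, and Blei's inequality. -/

section Fibres

variable {κ α ι : Type*} [Fintype κ] [DecidableEq κ] [Fintype α] [DecidableEq α] [Fintype ι]

/-- The sum of `c` over the fibre of `π` at `a`. -/
noncomputable def fiberSum (π : ι → α) (c : ι → ℝ) (a : α) : ℝ :=
  ∑ i with π i = a, c i

theorem fiberSum_nonneg {α ι : Type*} [DecidableEq α] [Fintype ι] {π : ι → α} {c : ι → ℝ} (hc : ∀ i, 0 ≤ c i) (a : α) :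
    0 ≤ fiberSum π c a :=
  Finset.sum_nonneg fun i _ => hc i

theorem le_fiberSum {α ι : Type*} [DecidableEq α] [Fintype ι] {π : ι → α} {c : ι → ℝ} (hc : ∀ i, 0 ≤ c i) (i : ι) :
    c i ≤ fiberSum π c (π i) :=
  Finset.single_le_sum (f := c) (fun j _ => hc j) (by simp)

/-- The functions `c * R ^ (τ - 1)` are the auxiliary Hölder factors below: their total mass is the
same for summation over `ι` as the mixed norm over `α`. -/
theorem sum_mul_fiberSum_rpow {π : ι → α} {c : ι → ℝ} (hc : ∀ i, 0 ≤ c i) {τ : ℝ} (hτ : 0 < τ) :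
    ∑ i, c i * fiberSum π c (π i) ^ (τ - 1) = ∑ a, fiberSum π c a ^ τ := by
  rw [← Finset.sum_fiberwise Finset.univ π]
  refine Finset.sum_congr rfl fun a _ => ?_
  have : ∀ i ∈ Finset.univ.filter (fun i => π i = a),
      c i * fiberSum π c (π i) ^ (τ - 1) = c i * fiberSum π c a ^ (τ - 1) := by
    intro i hi
    rw [(Finset.mem_filter.1 hi).2]
  rw [Finset.sum_congr rfl this, ← Finset.sum_mul]
  change fiberSum π c a * _ = _
  rcases (fiberSum_nonneg (π := π) hc a).eq_or_lt with h0 | h0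
  · rw [← h0, zero_mul, Real.zero_rpow hτ.ne']
  · rw [Real.rpow_sub_one h0.ne', mul_div_cancel₀ _ h0.ne']

/-- Mixed-norm inequality in normalised form: testing against the weights
`fiberSum (π j) c ^ τ` themselves. -/
theorem one_le_of_fiberSum_normalized (π : κ → ι → α) {c : ι → ℝ} (hc : ∀ i, 0 ≤ c i)
    {τ ρ : ℝ} {σ : κ → ℝ} (hτ : 0 < τ) (hτ1 : τ < 1) (hρ : 0 < ρ) (hσ : ∀ j, 0 ≤ σ j)
    (hρτ : 1 / ρ = 1 / τ + ∑ j, σ j)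
    (hM : ∀ j, ∑ a, fiberSum (π j) c a ^ τ ≤ 1) (k : κ)
    (hk : ∑ a, fiberSum (π k) c a ^ τ = 1) {B : ℝ}
    (hB : ∑ a, fiberSum (π k)
      (fun i => c i * ∏ j, (fiberSum (π j) c (π j i) ^ τ) ^ σ j) a ^ ρ ≤ B) : 1 ≤ B := by
  set R : κ → α → ℝ := fun j => fiberSum (π j) c with hR
  have hR0 : ∀ j a, 0 ≤ R j a := fun j a => fiberSum_nonneg hc a
  set u : ι → ℝ := fun i => c i * ∏ j, (R j (π j i) ^ τ) ^ σ j with hu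
  have hu0 : ∀ i, 0 ≤ u i := fun i => mul_nonneg (hc i) (Finset.prod_nonneg fun j _ =>
    Real.rpow_nonneg (Real.rpow_nonneg (hR0 _ _) _) _)
  set v : κ → ι → ℝ := fun j i => c i * R j (π j i) ^ (τ - 1) with hv
  have hv0 : ∀ j i, 0 ≤ v j i := fun j i => mul_nonneg (hc i) (Real.rpow_nonneg (hR0 _ _) _)
  set s : ℝ := ∑ j ∈ Finset.univ.erase k, σ j with hs
  have hs0 : 0 ≤ s := Finset.sum_nonneg fun j _ => hσ j
  have hd : 0 < 1 - τ := by linarith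
  -- `x` and `β` are determined by two demands on `u ^ x * ∏ v j ^ β j`: the powers of `R j`, `j ≠
  -- k`, cancel, and the exponents of `c` sum to one.
  set Δ : ℝ := 1 - τ + τ * s with hΔ
  have hΔ0 : 0 < Δ := by positivity
  set x : ℝ := (1 - τ) / Δ with hx
  have hx0 : 0 < x := by positivity
  set β : κ → ℝ := fun j => τ * σ j / Δ with hβ
  have hβ0 : ∀ j, 0 ≤ β j := fun j => div_nonneg (mul_nonneg hτ.le (hσ j)) hΔ0.le
  have hβs : ∑ j ∈ Finset.univ.erase k, β j = τ * s / Δ := by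
    simp only [hβ, hs, Finset.mul_sum, Finset.sum_div]
  have hxβ : x + ∑ j ∈ Finset.univ.erase k, β j = 1 := by
    rw [hβs, hx, ← add_div, ← hΔ, div_self hΔ0.ne']
  -- The power of `R k` that survives in `u ^ x`.
  set e : ℝ := τ * σ k * x with he
  have he0 : 0 ≤ e := by have := hσ k; positivity
  have hpt : ∀ i, c i * R k (π k i) ^ e ≤
      u i ^ x * ∏ j ∈ Finset.univ.erase k, v j i ^ β j := by
    intro i
    rcases (hc i).eq_or_lt with h0 | h0
    · rw [← h0, zero_mul]
      exact mul_nonneg (Real.rpow_nonneg (hu0 i) _)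
        (Finset.prod_nonneg fun j _ => Real.rpow_nonneg (hv0 j i) _)
    · have hRp : ∀ j, 0 < R j (π j i) := fun j => h0.trans_le (le_fiberSum hc i)
      have h1 : u i ^ x = c i ^ x * (R k (π k i) ^ e *
          ∏ j ∈ Finset.univ.erase k, R j (π j i) ^ (τ * σ j * x)) := by
        rw [hu]
        dsimp only
        rw [Real.mul_rpow h0.le (Finset.prod_nonneg fun j _ =>
          Real.rpow_nonneg (Real.rpow_nonneg (hR0 _ _) _) _),
          ← Real.finsetProd_rpow _ _ (fun j _ =>
          Real.rpow_nonneg (Real.rpow_nonneg (hR0 _ _) _) _),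
          ← Finset.mul_prod_erase _ _ (Finset.mem_univ k)]
        simp only [← Real.rpow_mul (hR0 _ _), he]
      have h2 : ∀ j, v j i ^ β j = c i ^ β j * R j (π j i) ^ (-(τ * σ j * x)) := by
        intro j
        rw [hv]
        dsimp only
        rw [Real.mul_rpow h0.le (Real.rpow_nonneg (hR0 _ _) _), ← Real.rpow_mul (hR0 _ _)]
        congr 2
        simp only [hβ, hx]
        ring
      have h3 : (∏ j ∈ Finset.univ.erase k, R j (π j i) ^ (τ * σ j * x)) *
          ∏ j ∈ Finset.univ.erase k, R j (π j i) ^ (-(τ * σ j * x)) = 1 := by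
        rw [← Finset.prod_mul_distrib]
        refine Finset.prod_eq_one fun j _ => ?_
        rw [← Real.rpow_add (hRp j), add_neg_cancel, Real.rpow_zero]
      have h4 : c i ^ x * ∏ j ∈ Finset.univ.erase k, c i ^ β j = c i := by
        rw [← Real.rpow_sum_of_pos h0, ← Real.rpow_add h0, hxβ, Real.rpow_one]
      rw [h1, Finset.prod_congr rfl (fun j _ => h2 j), Finset.prod_mul_distrib]
      refine le_of_eq ?_
      calc c i * R k (π k i) ^ e = (c i ^ x * ∏ j ∈ Finset.univ.erase k, c i ^ β j) *
          R k (π k i) ^ e * ((∏ j ∈ Finset.univ.erase k, R j (π j i) ^ (τ * σ j * x)) *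
          ∏ j ∈ Finset.univ.erase k, R j (π j i) ^ (-(τ * σ j * x))) := by
            rw [h3, h4, mul_one]
        _ = _ := by ring
  -- First Hölder, inside the fibre over `a`, where `R k` is constant.
  have hfib : ∀ a, R k a ^ (1 + e) ≤ fiberSum (π k) u a ^ x *
      ∏ j ∈ Finset.univ.erase k, fiberSum (π k) (v j) a ^ β j := by
    intro a
    have h1 : R k a ^ (1 + e) = ∑ i with π k i = a, c i * R k (π k i) ^ e := by
      have : ∀ i ∈ Finset.univ.filter (fun i => π k i = a),
          c i * R k (π k i) ^ e = c i * R k a ^ e := by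
        intro i hi
        rw [(Finset.mem_filter.1 hi).2]
      rw [Finset.sum_congr rfl this, ← Finset.sum_mul,
        Real.rpow_add' (hR0 k a) (by positivity), Real.rpow_one]
      rfl
    rw [h1]
    refine (Finset.sum_le_sum fun i _ => hpt i).trans ?_
    exact Real.sum_rpow_mul_prod_rpow_le _ _ u v x β (fun i _ => hu0 i)
      (fun j _ i _ => hv0 j i) hx0.le (fun j _ => hβ0 j) hxβ
  -- Raising to `γ` turns `R k ^ (1 + e)` into `R k ^ τ`, whose sum is one; the second Hölder runs
  -- over `a`.
  set γ : ℝ := τ / (1 + e) with hγ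
  have hγ0 : 0 < γ := by positivity
  have hU0 : ∀ a, 0 ≤ fiberSum (π k) u a := fun a => fiberSum_nonneg hu0 a
  have hV0 : ∀ j a, 0 ≤ fiberSum (π k) (v j) a := fun j a => fiberSum_nonneg (hv0 j) a
  have hfib' : ∀ a, R k a ^ τ ≤ (fiberSum (π k) u a ^ ρ) ^ (x * γ / ρ) *
      ∏ j ∈ Finset.univ.erase k, fiberSum (π k) (v j) a ^ (β j * γ) := by
    intro a
    have h1 := Real.rpow_le_rpow (Real.rpow_nonneg (hR0 k a) _) (hfib a) hγ0.le
    have h2 : (1 + e) * γ = τ := by rw [hγ]; field_simp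
    have h3 : ρ * (x * γ / ρ) = x * γ := by field_simp
    rw [← Real.rpow_mul (hR0 k a), h2, Real.mul_rpow (Real.rpow_nonneg (hU0 a) _)
      (Finset.prod_nonneg fun j _ => Real.rpow_nonneg (hV0 j a) _), ← Real.rpow_mul (hU0 a),
      ← Real.finsetProd_rpow _ _ (fun j _ => Real.rpow_nonneg (hV0 j a) _)] at h1
    simp only [← Real.rpow_mul (hV0 _ _)] at h1
    rwa [← Real.rpow_mul (hU0 a), h3]
  -- The relation `hρτ` is exactly what makes these weights sum to one.
  have hw1 : x * γ / ρ + ∑ j ∈ Finset.univ.erase k, β j * γ = 1 := by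
    have hsum : ∑ j, σ j = σ k + s := (Finset.add_sum_erase _ _ (Finset.mem_univ k)).symm
    have h1 : x * (1 / ρ) + τ * s / Δ = (1 + e) / τ := by
      rw [hρτ, hsum, he, hx]
      field_simp
      rw [hΔ]
      ring
    calc x * γ / ρ + ∑ j ∈ Finset.univ.erase k, β j * γ = (x * (1 / ρ) + τ * s / Δ) * γ := by
          rw [← Finset.sum_mul, hβs]; ring
      _ = 1 := by rw [h1, hγ]; field_simp
  have hV1 : ∀ j, ∑ a, fiberSum (π k) (v j) a ≤ 1 := by
    intro j
    have : ∑ a, fiberSum (π k) (v j) a = ∑ i, v j i := Finset.sum_fiberwise Finset.univ (π k) _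
    rw [this]
    exact (sum_mul_fiberSum_rpow hc hτ).trans_le (hM j)
  have hfinal : 1 ≤ (∑ a, fiberSum (π k) u a ^ ρ) ^ (x * γ / ρ) := by
    rw [← hk]
    refine (Finset.sum_le_sum fun a _ => hfib' a).trans ?_
    refine (Real.sum_rpow_mul_prod_rpow_le _ _ (fun a => fiberSum (π k) u a ^ ρ)
      (fun j => fiberSum (π k) (v j)) (x * γ / ρ) (fun j => β j * γ)
      (fun a _ => Real.rpow_nonneg (hU0 a) _) (fun j _ a _ => hV0 j a) (by positivity)
      (fun j _ => mul_nonneg (hβ0 j) hγ0.le) hw1).trans ?_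
    refine mul_le_of_le_one_right (Real.rpow_nonneg (Finset.sum_nonneg fun a _ =>
      Real.rpow_nonneg (hU0 a) _) _) ?_
    refine Finset.prod_le_one (fun j _ => Real.rpow_nonneg (Finset.sum_nonneg fun a _ =>
      hV0 j a) _) fun j _ => Real.rpow_le_one (Finset.sum_nonneg fun a _ =>
      hV0 j a) (hV1 j) (mul_nonneg (hβ0 j) hγ0.le)
  by_contra! hlt
  exact absurd hfinal (not_le.2 (Real.rpow_lt_one (Finset.sum_nonneg fun a _ =>
      Real.rpow_nonneg (hU0 a) _) (hB.trans_lt hlt) (by positivity)))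

end Fibres

/-- Blei's inequality, normalised: control of all the one-coordinate mixed norms
controls an `ℓ_ν` norm. -/
theorem sum_rpow_le_one_of_fiberSum {κ α : Type*} [Fintype κ] [DecidableEq κ] [Nonempty κ]
    [Fintype α] [DecidableEq α] {c : (κ → α) → ℝ} (hc : ∀ i, 0 ≤ c i) {τ ν : ℝ} (hτ : 0 < τ)
    (hτ1 : τ < 1) (hν : 0 < ν)
    (hντ : 1 / ν = 1 / (Fintype.card κ * τ) + (Fintype.card κ - 1) / Fintype.card κ)
    (hM : ∀ j : κ, ∑ a, fiberSum (fun i : κ → α => i j) c a ^ τ ≤ 1) :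
    ∑ i, c i ^ ν ≤ 1 := by
  set m : ℝ := (Fintype.card κ : ℝ) with hm
  have hm1 : 1 ≤ m := by rw [hm]; exact_mod_cast Fintype.card_pos
  have hm0 : 0 < m := by linarith
  set R : κ → α → ℝ := fun j => fiberSum (fun i : κ → α => i j) c with hR
  have hR0 : ∀ j a, 0 ≤ R j a := fun j a => fiberSum_nonneg hc a
  have hrel : m * τ = ν * (1 + (m - 1) * τ) := by field_simp at hντ; linarith
  -- Needed because `1 - ν` is a Hölder weight below.
  have hν1 : ν ≤ 1 := by
    have : 0 < 1 + (m - 1) * τ := by nlinarith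
    by_contra! h
    nlinarith
  -- By `hrel`, each `R j` has total exponent zero on the right; the remaining power of `c i` is
  -- `ν`.
  have hpt : ∀ i, c i ^ ν ≤ (∏ j, R j (i j) ^ τ) ^ (1 - ν) *
      ∏ j, (c i * R j (i j) ^ (τ - 1)) ^ (ν / m) := by
    intro i
    have hnn : 0 ≤ (∏ j, R j (i j) ^ τ) ^ (1 - ν) *
      ∏ j, (c i * R j (i j) ^ (τ - 1)) ^ (ν / m) :=
      mul_nonneg (Real.rpow_nonneg (Finset.prod_nonneg fun j _ => Real.rpow_nonneg (hR0 _ _) _) _)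
        (Finset.prod_nonneg fun j _ => Real.rpow_nonneg
          (mul_nonneg (hc i) (Real.rpow_nonneg (hR0 _ _) _)) _)
    rcases (hc i).eq_or_lt with h0 | h0
    · rw [← h0] at hnn ⊢
      rwa [Real.zero_rpow hν.ne']
    · have hRp : ∀ j, 0 < R j (i j) := fun j =>
        h0.trans_le (le_fiberSum (π := fun i : κ → α => i j) hc i)
      refine le_of_eq ?_
      rw [← Real.finsetProd_rpow _ _ (fun j _ => Real.rpow_nonneg (hR0 _ _) _),
        ← Finset.prod_mul_distrib]
      have : ∀ j, (R j (i j) ^ τ) ^ (1 - ν) * (c i * R j (i j) ^ (τ - 1)) ^ (ν / m) =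
          c i ^ (ν / m) := by
        intro j
        rw [Real.mul_rpow h0.le (Real.rpow_nonneg (hR0 _ _) _), ← Real.rpow_mul (hR0 _ _),
          ← Real.rpow_mul (hR0 _ _), mul_left_comm, ← Real.rpow_add (hRp j)]
        have : τ * (1 - ν) + (τ - 1) * (ν / m) = 0 := by
          field_simp
          linarith
        rw [this, Real.rpow_zero, mul_one]
      rw [Finset.prod_congr rfl (fun j _ => this j), Finset.prod_const, Finset.card_univ,
        ← Real.rpow_natCast, ← Real.rpow_mul h0.le, ← hm, div_mul_cancel₀ _ hm0.ne']
  refine (Finset.sum_le_sum fun i _ => hpt i).trans ?_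
  refine (Real.sum_rpow_mul_prod_rpow_le _ _ (fun i => ∏ j, R j (i j) ^ τ)
    (fun j i => c i * R j (i j) ^ (τ - 1)) (1 - ν) (fun _ => ν / m)
    (fun i _ => Finset.prod_nonneg fun j _ => Real.rpow_nonneg (hR0 _ _) _)
    (fun j _ i _ => mul_nonneg (hc i) (Real.rpow_nonneg (hR0 _ _) _)) (by linarith)
    (fun _ _ => by positivity) ?_).trans ?_
  · rw [Finset.sum_const, Finset.card_univ, nsmul_eq_mul, ← hm]
    field_simp
    ring
  -- The full product index set makes this sum factor.
  · have h1 : ∑ i : κ → α, ∏ j, R j (i j) ^ τ = ∏ j, ∑ a, R j a ^ τ := by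
      rw [Finset.prod_univ_sum, Fintype.piFinset_univ]
    have h2 : 0 ≤ ∏ j, ∑ a, R j a ^ τ := Finset.prod_nonneg fun j _ => Finset.sum_nonneg fun a _ =>
      Real.rpow_nonneg (hR0 _ _) _
    have h3 : ∀ j, ∑ i, c i * R j (i j) ^ (τ - 1) = ∑ a, R j a ^ τ := fun j =>
      sum_mul_fiberSum_rpow hc hτ
    rw [h1]
    refine mul_le_one₀ (Real.rpow_le_one h2 (Finset.prod_le_one (fun j _ =>
      Finset.sum_nonneg fun a _ => Real.rpow_nonneg (hR0 _ _) _) fun j _ => hM j) (by linarith))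
      (Finset.prod_nonneg fun j _ => ?_) (Finset.prod_le_one (fun j _ => ?_) fun j _ => ?_)
    · rw [h3]
      exact Real.rpow_nonneg (Finset.sum_nonneg fun a _ => Real.rpow_nonneg (hR0 _ _) _) _
    · rw [h3]
      exact Real.rpow_nonneg (Finset.sum_nonneg fun a _ => Real.rpow_nonneg (hR0 _ _) _) _
    · rw [h3]
      exact Real.rpow_le_one (Finset.sum_nonneg fun a _ => Real.rpow_nonneg (hR0 _ _) _)
        (hM j) (by positivity)

theorem fiberSum_div {α ι : Type*} [DecidableEq α] [Fintype ι] (π : ι → α) (c : ι → ℝ) (A : ℝ)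
    (a : α) : fiberSum π (fun i => c i / A) a = fiberSum π c a / A := by
  simp only [fiberSum, Finset.sum_div]

/-- If the weighted mixed `(r, q)`-norms of `b` are bounded by `K` for all weights `z j ^ s j` with
`z j` in the simplex, then the `ℓ_μ`-norm of `b` is at most `K`. -/
theorem sum_rpow_le_of_weighted_mixed {κ α : Type*} [Fintype κ] [DecidableEq κ] [Nonempty κ]
    [Fintype α] [DecidableEq α] {b : (κ → α) → ℝ} (hb : ∀ i, 0 ≤ b i) {r l q μ K : ℝ} {s : κ → ℝ}
    (hr : 0 < r) (hl : 0 < l) (hlq : l < q) (hμ : 0 < μ) (hK : 0 ≤ K) (hs : ∀ j, 0 ≤ s j)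
    (hrl : 1 / r = 1 / l + ∑ j, s j)
    (hμl : 1 / μ = 1 / (Fintype.card κ * l) + (Fintype.card κ - 1) / (Fintype.card κ * q))
    (H : ∀ z : κ → α → ℝ, (∀ j a, 0 ≤ z j a) → (∀ j, ∑ a, z j a ≤ 1) → ∀ k,
      ∑ a, fiberSum (fun i : κ → α => i k) (fun i => (b i * ∏ j, z j (i j) ^ s j) ^ q) a ^ (r / q)
        ≤ K ^ r) :
    ∑ i, b i ^ μ ≤ K ^ μ := by
  have hq : 0 < q := hl.trans hlq
  have hτ : 0 < l / q := by positivity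
  have hbq : ∀ i, 0 ≤ b i ^ q := fun i => Real.rpow_nonneg (hb i) _
  set M : κ → ℝ := fun j => ∑ a, fiberSum (fun i : κ → α => i j) (fun i => b i ^ q) a ^ (l / q)
    with hM
  -- Normalising by the largest mixed norm puts every test weight in the simplex, with mass exactly
  -- one at `k`.
  obtain ⟨k, hk⟩ := Finite.exists_max M
  have hM0 : 0 ≤ M k := Finset.sum_nonneg fun a _ => Real.rpow_nonneg (fiberSum_nonneg hbq a) _
  rcases hM0.eq_or_lt with h0 | h0
  · have hb0 : ∀ i, b i = 0 := by
      intro i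
      have h1 := (Finset.sum_eq_zero_iff_of_nonneg (fun a _ =>
        Real.rpow_nonneg (fiberSum_nonneg hbq a) _)).1 h0.symm (i k) (Finset.mem_univ _)
      rw [Real.rpow_eq_zero (fiberSum_nonneg hbq _) hτ.ne'] at h1
      have h2 := le_fiberSum (π := fun i : κ → α => i k) hbq i
      rw [h1] at h2
      exact (Real.rpow_eq_zero (hb i) hq.ne').1 (le_antisymm h2 (hbq i))
    simp only [hb0, Real.zero_rpow hμ.ne', Finset.sum_const_zero]
    exact Real.rpow_nonneg hK _
  set L : ℝ := M k ^ (1 / l) with hL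
  have hL0 : 0 < L := Real.rpow_pos_of_pos h0 _
  have hLl : L ^ l = M k := by rw [hL, ← Real.rpow_mul hM0, one_div_mul_cancel hl.ne', Real.rpow_one]
  have hLq : (L ^ q) ^ (l / q) = M k := by
    rw [← Real.rpow_mul hL0.le, mul_div_cancel₀ _ hq.ne', hLl]
  set c : (κ → α) → ℝ := fun i => b i ^ q / L ^ q with hc
  have hc0 : ∀ i, 0 ≤ c i := fun i => div_nonneg (hbq i) (Real.rpow_nonneg hL0.le _)
  have hMc : ∀ j, ∑ a, fiberSum (fun i : κ → α => i j) c a ^ (l / q) = M j / M k := by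
    intro j
    simp only [hc, fiberSum_div, Real.div_rpow (fiberSum_nonneg hbq _) (Real.rpow_nonneg hL0.le _),
      hLq, ← Finset.sum_div, hM]
  have hMc1 : ∀ j, ∑ a, fiberSum (fun i : κ → α => i j) c a ^ (l / q) ≤ 1 := fun j => by
    rw [hMc]; exact div_le_one_of_le₀ (hk j) hM0
  set z : κ → α → ℝ := fun j a => fiberSum (fun i : κ → α => i j) c a ^ (l / q) with hz
  have hz0 : ∀ j a, 0 ≤ z j a := fun j a => Real.rpow_nonneg (fiberSum_nonneg hc0 a) _
  have hH := H z hz0 hMc1 k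
  have hKL : 1 ≤ (K / L) ^ r := by
    refine one_le_of_fiberSum_normalized (fun (j : κ) (i : κ → α) => i j) hc0
      (τ := l / q) (ρ := r / q) (σ := fun j => q * s j) hτ ((div_lt_one hq).2 hlq) (by positivity)
      (fun j => mul_nonneg hq.le (hs j)) ?_ hMc1 k (by rw [hMc, div_self h0.ne']) ?_
    · rw [← Finset.mul_sum, one_div_div, one_div_div, ← mul_one_div, hrl]
      ring
    · have h1 : ∀ i, c i * ∏ j, (fiberSum (fun i : κ → α => i j) c (i j) ^ (l / q)) ^ (q * s j) =
          (b i * ∏ j, z j (i j) ^ s j) ^ q / L ^ q := by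
        intro i
        rw [Real.mul_rpow (hb i) (Finset.prod_nonneg fun j _ => Real.rpow_nonneg (hz0 _ _) _),
          ← Real.finsetProd_rpow _ _ (fun j _ => Real.rpow_nonneg (hz0 _ _) _), mul_div_right_comm]
        congr 1
        refine Finset.prod_congr rfl fun j _ => ?_
        rw [← Real.rpow_mul (hz0 _ _), mul_comm q]
      have h2 : (L ^ q) ^ (r / q) = L ^ r := by
        rw [← Real.rpow_mul hL0.le, mul_div_cancel₀ _ hq.ne']
      have h3 : ∀ i, 0 ≤ (b i * ∏ j, z j (i j) ^ s j) ^ q := fun i =>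
        Real.rpow_nonneg (mul_nonneg (hb i) (Finset.prod_nonneg fun j _ =>
          Real.rpow_nonneg (hz0 _ _) _)) _
      simp only [h1, fiberSum_div, Real.div_rpow (fiberSum_nonneg h3 _)
        (Real.rpow_nonneg hL0.le _), h2, ← Finset.sum_div]
      rw [Real.div_rpow hK hL0.le]
      exact div_le_div_of_nonneg_right hH (Real.rpow_nonneg hL0.le _)
  have hLK : L ≤ K := by
    by_contra! h
    exact absurd hKL (not_le.2 (Real.rpow_lt_one (by positivity) ((div_lt_one hL0).2 h) hr))
  have hfin := sum_rpow_le_one_of_fiberSum (κ := κ) (α := α) hc0 (τ := l / q) (ν := μ / q) hτ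
    ((div_lt_one hq).2 hlq) (by positivity) ?_ hMc1
  · have h1 : ∀ i, c i ^ (μ / q) = b i ^ μ / L ^ μ := by
      intro i
      rw [hc]
      dsimp only
      rw [Real.div_rpow (hbq i) (Real.rpow_nonneg hL0.le _), ← Real.rpow_mul (hb i),
        ← Real.rpow_mul hL0.le, mul_div_cancel₀ _ hq.ne']
    simp only [h1, ← Finset.sum_div] at hfin
    rw [div_le_one (Real.rpow_pos_of_pos hL0 _)] at hfin
    exact hfin.trans (Real.rpow_le_rpow hL0.le hLK hμ.le)
  · rw [one_div_div, ← mul_one_div, hμl]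
    have : (0 : ℝ) < Fintype.card κ := by exact_mod_cast Fintype.card_pos
    field_simp

/-! ### Averages over signs and Kahane's inequality. -/

section SignMeans

theorem expect_units_int (g : ℤˣ → ℝ) : 𝔼 x, g x = (g 1 + g (-1)) / 2 := by
  rw [Fintype.expect_eq_sum_div_card, show (Finset.univ : Finset ℤˣ) = {1, -1} from rfl,
    Finset.sum_pair (by decide), Fintype.card_units_int, Nat.cast_ofNat]

theorem expect_fin_succ {β : Type*} [Fintype β] {n : ℕ} (f : (Fin (n + 1) → β) → ℝ) :
    𝔼 e, f e = 𝔼 x, 𝔼 e, f (Fin.cons x e) := by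
  rw [← Finset.expect_product', Finset.univ_product_univ]
  exact (Fintype.expect_equiv (Fin.consEquiv fun _ => β) _ _ fun _ => rfl).symm

theorem expect_sign_succ {n : ℕ} (f : (Fin (n + 1) → ℤˣ) → ℝ) :
    𝔼 e, f e = 𝔼 e : Fin n → ℤˣ, (f (Fin.cons 1 e) + f (Fin.cons (-1) e)) / 2 := by
  rw [expect_fin_succ, expect_units_int, ← Finset.expect_add_distrib, Finset.expect_div]

theorem expect_comp_neg {n : ℕ} (f : (Fin n → ℤˣ) → ℝ) : 𝔼 e, f (-e) = 𝔼 e, f e :=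
  Fintype.expect_equiv (Equiv.neg _) _ _ fun _ => rfl

/-- Change the sign of the `i`-th coordinate. -/
def flipSign {n : ℕ} (i : Fin n) (e : Fin n → ℤˣ) : Fin n → ℤˣ :=
  Function.update e i (-e i)

theorem flipSign_involutive {n : ℕ} (i : Fin n) : Function.Involutive (flipSign i) := by
  intro e
  simp [flipSign]

theorem expect_comp_flipSign {n : ℕ} (i : Fin n) (f : (Fin n → ℤˣ) → ℝ) :
    𝔼 e, f (flipSign i e) = 𝔼 e, f e :=
  Fintype.expect_equiv (flipSign_involutive i).toPerm _ _ fun _ => rfl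

theorem sq_expect_le {ι : Type*} [Fintype ι] (f : ι → ℝ) : (𝔼 i, f i) ^ 2 ≤ 𝔼 i, f i ^ 2 := by
  rcases isEmpty_or_nonempty ι with h | h
  · simp
  · have := Finset.expect_mul_sq_le_sq_mul_sq Finset.univ f (fun _ => (1 : ℝ))
    simpa using this

theorem neg_cons_sign {n : ℕ} (x : ℤˣ) (e : Fin n → ℤˣ) :
    -(Fin.cons x e : Fin (n + 1) → ℤˣ) = Fin.cons (-x) (-e) := by
  funext j
  refine Fin.cases ?_ (fun j => ?_) j <;> simp

/-- Poincaré's inequality on the cube with a gain on the even part of the function. -/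
theorem poincare_sign_even {n : ℕ} (h : (Fin n → ℤˣ) → ℝ) :
    (𝔼 e, h e ^ 2) + (𝔼 e, ((h e + h (-e)) / 2) ^ 2) - 2 * (𝔼 e, h e) ^ 2 ≤
      1 / 4 * ∑ i, 𝔼 e, (h e - h (flipSign i e)) ^ 2 := by
  -- In Walsh coefficients, the left side gives a set `S` the factor 0 if it is empty, 1 if `|S|` is
  -- odd and 2 otherwise, while the right side gives `|S|`. The induction splits off the first sign:
  -- `h = s ± d`.
  induction n with
  | zero =>
    have h1 : ∀ e : Fin 0 → ℤˣ, h e = h 1 := fun e => congrArg h (Subsingleton.elim _ _)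
    simp only [h1, Fintype.expect_const, Finset.univ_eq_empty, Finset.sum_empty]
    apply le_of_eq
    ring
  | succ n ih =>
    set s : (Fin n → ℤˣ) → ℝ := fun e => (h (Fin.cons 1 e) + h (Fin.cons (-1) e)) / 2 with hs
    set d : (Fin n → ℤˣ) → ℝ := fun e => (h (Fin.cons 1 e) - h (Fin.cons (-1) e)) / 2 with hd
    have a1 : 𝔼 e, h e ^ 2 = (𝔼 e, s e ^ 2) + 𝔼 e, d e ^ 2 := by
      rw [expect_sign_succ, ← Finset.expect_add_distrib]
      refine Finset.expect_congr rfl fun e _ => ?_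
      simp only [hs, hd]
      ring
    have a2 : 𝔼 e, h e = 𝔼 e, s e := expect_sign_succ _
    have a3 : 𝔼 e, ((h e + h (-e)) / 2) ^ 2 =
        (𝔼 e, ((s e + s (-e)) / 2) ^ 2) + 𝔼 e, ((d e - d (-e)) / 2) ^ 2 := by
      rw [expect_sign_succ, ← Finset.expect_add_distrib]
      refine Finset.expect_congr rfl fun e _ => ?_
      simp only [hs, hd, neg_cons_sign, neg_neg]
      ring
    have a4 : ∑ i, 𝔼 e, (h e - h (flipSign i e)) ^ 2 =
        (∑ i, 𝔼 e, (s e - s (flipSign i e)) ^ 2) + (∑ i, 𝔼 e, (d e - d (flipSign i e)) ^ 2) +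
          4 * 𝔼 e, d e ^ 2 := by
      rw [Fin.sum_univ_succ, ← Finset.sum_add_distrib, add_comm]
      congr 1
      · refine Finset.sum_congr rfl fun i _ => ?_
        rw [expect_sign_succ, ← Finset.expect_add_distrib]
        refine Finset.expect_congr rfl fun e _ => ?_
        simp only [hs, hd, flipSign, Fin.cons_succ, ← Fin.cons_update]
        ring
      · rw [expect_sign_succ, Finset.mul_expect]
        refine Finset.expect_congr rfl fun e _ => ?_
        simp only [hd, flipSign, Fin.cons_zero, Fin.update_cons_zero, neg_neg]
        ring
    have a5 : 𝔼 e, d e ^ 2 =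
        (𝔼 e, ((d e + d (-e)) / 2) ^ 2) + 𝔼 e, ((d e - d (-e)) / 2) ^ 2 := by
      have h1 : 𝔼 e, d e ^ 2 = 𝔼 e, (d e ^ 2 + d (-e) ^ 2) / 2 := by
        rw [← Finset.expect_div, Finset.expect_add_distrib, expect_comp_neg (fun e => d e ^ 2)]
        ring
      rw [h1, ← Finset.expect_add_distrib]
      refine Finset.expect_congr rfl fun e _ => ?_
      ring
    have a6 : (𝔼 e, d e) ^ 2 ≤ 𝔼 e, ((d e + d (-e)) / 2) ^ 2 := by
      have h1 : 𝔼 e, (d e + d (-e)) / 2 = 𝔼 e, d e := by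
        rw [← Finset.expect_div, Finset.expect_add_distrib, expect_comp_neg d]
        ring
      rw [← h1]
      exact sq_expect_le _
    have i1 := ih s
    have i2 := ih d
    rw [a1, a2, a3, a4]
    linarith

/-- A nonnegative even function on the cube with `∑ i, (f - f ∘ flipSign i) ≤ 2 f` has comparable
first and second moments. -/
theorem expect_sq_le_two_mul_sq_expect {n : ℕ} {f : (Fin n → ℤˣ) → ℝ} (hf : ∀ e, 0 ≤ f e)
    (heven : ∀ e, f (-e) = f e) (hL : ∀ e, ∑ i, (f e - f (flipSign i e)) ≤ 2 * f e) :
    𝔼 e, f e ^ 2 ≤ 2 * (𝔼 e, f e) ^ 2 := by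
  have h1 := poincare_sign_even f
  have h2 : 𝔼 e, ((f e + f (-e)) / 2) ^ 2 = 𝔼 e, f e ^ 2 :=
    Finset.expect_congr rfl fun e _ => by rw [heven]; ring
  have h3 : ∀ i, 𝔼 e, (f e - f (flipSign i e)) ^ 2 =
      2 * 𝔼 e, f e * (f e - f (flipSign i e)) := by
    intro i
    have : ∀ e, (f e - f (flipSign i e)) ^ 2 =
        2 * (f e * (f e - f (flipSign i e))) - (f e ^ 2 - f (flipSign i e) ^ 2) := by
      intro e; ring
    simp only [this]
    rw [Finset.expect_sub_distrib, Finset.expect_sub_distrib,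
      expect_comp_flipSign i (fun e => f e ^ 2), sub_self, sub_zero, Finset.mul_expect]
  have h4 : ∑ i, 𝔼 e, (f e - f (flipSign i e)) ^ 2 ≤ 4 * 𝔼 e, f e ^ 2 := by
    simp only [h3]
    rw [← Finset.mul_sum, ← Finset.expect_sum_comm]
    simp only [← Finset.mul_sum]
    have : 𝔼 e, f e * ∑ i, (f e - f (flipSign i e)) ≤ 𝔼 e, 2 * f e ^ 2 := by
      refine Finset.expect_le_expect fun e _ => ?_
      have := mul_le_mul_of_nonneg_left (hL e) (hf e)
      linarith
    rw [← Finset.mul_expect] at this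
    linarith
  rw [h2] at h1
  linarith

/-- Kahane's inequality between the first and the second moment, with the constant of
Latała and Oleszkiewicz. -/
theorem expect_norm_sq_le {Y : Type*} [NormedAddCommGroup Y] {n : ℕ} [NormedSpace ℝ Y]
    (x : Fin n → Y) :
    𝔼 e : Fin n → ℤˣ, ‖∑ k, e k • x k‖ ^ 2 ≤ 2 * (𝔼 e : Fin n → ℤˣ, ‖∑ k, e k • x k‖) ^ 2 := by
  refine expect_sq_le_two_mul_sq_expect (fun e => norm_nonneg _) (fun e => ?_) fun e => ?_
  · simp [Units.smul_def, Finset.sum_neg_distrib]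
  · have h1 : ∀ i, ∑ k, flipSign i e k • x k = ∑ k, e k • x k - (2 : ℝ) • (e i • x i) := by
      intro i
      rw [eq_sub_iff_add_eq, ← eq_sub_iff_add_eq', ← Finset.sum_sub_distrib,
        Finset.sum_eq_single i]
      · simp [flipSign, Units.smul_def, two_smul]
      · intro k _ hk
        simp [flipSign, Function.update_of_ne hk]
      · simp
    -- Each term is flipped once and kept `n - 1` times.
    have h2 : ∑ i, ∑ k, flipSign i e k • x k = ((n : ℝ) - 2) • ∑ k, e k • x k := by
      simp only [h1]
      rw [Finset.sum_sub_distrib, ← Finset.smul_sum, Finset.sum_const, Finset.card_univ,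
        Fintype.card_fin, sub_smul, Nat.cast_smul_eq_nsmul]
    have h3 : ((n : ℝ) - 2) * ‖∑ k, e k • x k‖ ≤ ∑ i, ‖∑ k, flipSign i e k • x k‖ := by
      calc ((n : ℝ) - 2) * ‖∑ k, e k • x k‖ ≤ |(n : ℝ) - 2| * ‖∑ k, e k • x k‖ :=
            mul_le_mul_of_nonneg_right (le_abs_self _) (norm_nonneg _)
        _ = ‖∑ i, ∑ k, flipSign i e k • x k‖ := by rw [h2, norm_smul, Real.norm_eq_abs]
        _ ≤ _ := norm_sum_le _ _
    rw [Finset.sum_sub_distrib, Finset.sum_const, Finset.card_univ, Fintype.card_fin, nsmul_eq_mul]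
    linarith

end SignMeans

/-! ### Rademacher integrals as averages over signs. -/

section RademacherIntegral

theorem measurable_rademacher (k : ℕ) : Measurable (rademacher k) := by
  have h1 : Measurable Real.sign := by
    unfold Real.sign
    exact Measurable.ite measurableSet_Iio measurable_const
      (Measurable.ite measurableSet_Ioi measurable_const measurable_const)
  exact h1.comp (by fun_prop)

theorem abs_rademacher_le_one (k : ℕ) (t : ℝ) : |rademacher k t| ≤ 1 := by
  rcases Real.sign_apply_eq (Real.sin (2 ^ k * Real.pi * t)) with h | h | h <;>
    simp [rademacher, h]

theorem rademacher_succ (k : ℕ) (t : ℝ) : rademacher (k + 1) t = rademacher k (2 * t) := by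
  unfold rademacher
  congr 2
  ring

/-- The index must be positive: `rademacher 0` changes sign under this shift. -/
theorem rademacher_sub_one (k : ℕ) (t : ℝ) :
    rademacher (k + 1) (t - 1) = rademacher (k + 1) t := by
  unfold rademacher
  congr 1
  have : (2 : ℝ) ^ (k + 1) * Real.pi * (t - 1) =
      2 ^ (k + 1) * Real.pi * t - (2 ^ k : ℕ) * (2 * Real.pi) := by
    push_cast
    ring
  rw [this, Real.sin_sub_nat_mul_two_pi]

theorem rademacher_one_of_lt_half {t : ℝ} (h0 : 0 < t) (h1 : t < 1 / 2) : rademacher 1 t = 1 := by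
  unfold rademacher
  have := Real.pi_pos
  exact Real.sign_of_pos (Real.sin_pos_of_pos_of_lt_pi (by positivity) (by nlinarith))

theorem rademacher_one_of_half_lt {t : ℝ} (h0 : 1 / 2 < t) (h1 : t < 1) : rademacher 1 t = -1 := by
  unfold rademacher
  have := Real.pi_pos
  refine Real.sign_of_neg ?_
  rw [← Real.sin_sub_two_pi]
  exact Real.sin_neg_of_neg_of_neg_pi_lt (by nlinarith) (by nlinarith)

variable {Y : Type*} [NormedAddCommGroup Y] [NormedSpace ℂ Y]

theorem intervalIntegrable_norm_rademacher {n : ℕ} (x0 : Y) (x : Fin n → Y) (a b : ℝ) :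
    IntervalIntegrable
      (fun t => ‖x0 + ∑ k : Fin n, ((rademacher (k.val + 1) t : ℝ) : ℂ) • x k‖ ^ 2)
      MeasureTheory.volume a b := by
  have hsm : MeasureTheory.StronglyMeasurable
      (fun t => x0 + ∑ k : Fin n, ((rademacher (k.val + 1) t : ℝ) : ℂ) • x k) := by
    refine MeasureTheory.stronglyMeasurable_const.add ?_
    refine Finset.stronglyMeasurable_fun_sum _ fun k _ => ?_
    exact (Complex.measurable_ofReal.comp
      (measurable_rademacher _)).stronglyMeasurable.smul_const (x k)
  rw [intervalIntegrable_iff]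
  refine MeasureTheory.Measure.integrableOn_of_bounded (M := (‖x0‖ + ∑ k, ‖x k‖) ^ 2) ?_ ?_ ?_
  · simp
  · exact (hsm.norm.pow 2).aestronglyMeasurable
  · refine Filter.Eventually.of_forall fun t => ?_
    rw [Real.norm_of_nonneg (by positivity)]
    refine pow_le_pow_left₀ (norm_nonneg _) ((norm_add_le _ _).trans ?_) 2
    gcongr
    refine (norm_sum_le _ _).trans (Finset.sum_le_sum fun k _ => ?_)
    rw [norm_smul, Complex.norm_real]
    exact mul_le_of_le_one_left (norm_nonneg _) (abs_rademacher_le_one _ _)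

/-- Integrals of Rademacher sums are means over all choices of signs. -/
theorem integral_norm_rademacher {n : ℕ} (x0 : Y) (x : Fin n → Y) :
    ∫ t in (0 : ℝ)..1, ‖x0 + ∑ k : Fin n, ((rademacher (k.val + 1) t : ℝ) : ℂ) • x k‖ ^ 2 =
      𝔼 e : Fin n → ℤˣ, ‖x0 + ∑ k, e k • x k‖ ^ 2 := by
  -- The free vector `x0` absorbs the first term, whose sign is constant on each half of the
  -- interval; rescaling each half shifts the remaining indices down.
  induction n generalizing x0 with
  | zero => simp
  | succ n ih =>
    set F : Y → ℝ → ℝ := fun y t =>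
      ‖y + ∑ k : Fin n, ((rademacher (k.val + 1) t : ℝ) : ℂ) • x k.succ‖ ^ 2 with hF
    have hl : ∫ t in (0 : ℝ)..(1 / 2),
        ‖x0 + ∑ k : Fin (n + 1), ((rademacher (k.val + 1) t : ℝ) : ℂ) • x k‖ ^ 2 =
        (∫ t in (0 : ℝ)..1, F (x0 + x 0) t) / 2 := by
      have h1 : ∫ t in (0 : ℝ)..(1 / 2),
          ‖x0 + ∑ k : Fin (n + 1), ((rademacher (k.val + 1) t : ℝ) : ℂ) • x k‖ ^ 2 =
          ∫ t in (0 : ℝ)..(1 / 2), F (x0 + x 0) (2 * t) := by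
        -- Open intervals avoid the endpoints, where `Real.sign` takes the value 0.
        refine intervalIntegral.integral_congr_Ioo_of_le (by norm_num) fun t ht => ?_
        have h2 : ∀ k : Fin n, rademacher (k.val + 1 + 1) t = rademacher (k.val + 1) (2 * t) :=
          fun k => rademacher_succ _ t
        simp only [hF, Fin.sum_univ_succ, Fin.val_zero, Fin.val_succ, zero_add,
          rademacher_one_of_lt_half ht.1 ht.2, h2, Complex.ofReal_one, one_smul, ← add_assoc]
      rw [h1, intervalIntegral.integral_comp_mul_left _ (by norm_num)]
      norm_num
      ring
    have hr : ∫ t in (1 / 2 : ℝ)..1,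
        ‖x0 + ∑ k : Fin (n + 1), ((rademacher (k.val + 1) t : ℝ) : ℂ) • x k‖ ^ 2 =
        (∫ t in (0 : ℝ)..1, F (x0 - x 0) t) / 2 := by
      have h1 : ∫ t in (1 / 2 : ℝ)..1,
          ‖x0 + ∑ k : Fin (n + 1), ((rademacher (k.val + 1) t : ℝ) : ℂ) • x k‖ ^ 2 =
          ∫ t in (1 / 2 : ℝ)..1, F (x0 - x 0) (2 * t - 1) := by
        refine intervalIntegral.integral_congr_Ioo_of_le (by norm_num) fun t ht => ?_
        have h2 : ∀ k : Fin n,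
            rademacher (k.val + 1 + 1) t = rademacher (k.val + 1) (2 * t - 1) :=
          fun k => by rw [rademacher_succ, rademacher_sub_one]
        simp only [hF, Fin.sum_univ_succ, Fin.val_zero, Fin.val_succ, zero_add,
          rademacher_one_of_half_lt ht.1 ht.2, h2, Complex.ofReal_neg, Complex.ofReal_one,
          neg_smul, one_smul, ← add_assoc, sub_eq_add_neg]
      rw [h1, intervalIntegral.integral_comp_mul_sub _ (by norm_num)]
      norm_num
      ring
    rw [← intervalIntegral.integral_add_adjacent_intervals
      (intervalIntegrable_norm_rademacher x0 x 0 (1 / 2))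
      (intervalIntegrable_norm_rademacher x0 x (1 / 2) 1), hl, hr]
    simp only [hF]
    rw [ih, ih, ← add_div, ← Finset.expect_add_distrib, Finset.expect_div, expect_sign_succ]
    refine Finset.expect_congr rfl fun e _ => ?_
    simp [Fin.sum_univ_succ, add_assoc, sub_eq_add_neg]

end RademacherIntegral

/-! ### Minkowski's inequality and iterated cotype. -/

theorem finNorm_eq_sum {E : Type*} [NormedAddCommGroup E] {s : ℝ≥0∞} (hs : 0 < s.toReal) {N : ℕ}
    (x : Fin N → E) : finNorm s x = (∑ k, ‖x k‖ ^ s.toReal) ^ (1 / s.toReal) :=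
  PiLp.norm_eq_sum hs _

/-- Minkowski's inequality for means of finite families. -/
theorem rpow_sum_expect_le {ι Ω : Type*} [Fintype ι] [Fintype Ω] {q : ℝ} (hq : 1 ≤ q)
    {g : Ω → ι → ℝ} (hg : ∀ e i, 0 ≤ g e i) :
    (∑ i, (𝔼 e, g e i) ^ q) ^ (1 / q) ≤ 𝔼 e, (∑ i, g e i ^ q) ^ (1 / q) := by
  have hq0 : 0 < (ENNReal.ofReal q).toReal := by rw [ENNReal.toReal_ofReal] <;> linarith
  have : Fact (1 ≤ ENNReal.ofReal q) := ⟨by simpa using hq⟩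
  have hnorm : ∀ f : ι → ℝ, (∀ i, 0 ≤ f i) →
      ‖(WithLp.toLp (ENNReal.ofReal q) f : PiLp (ENNReal.ofReal q) (fun _ : ι => ℝ))‖ =
        (∑ i, f i ^ q) ^ (1 / q) := by
    intro f hf
    rw [PiLp.norm_eq_sum hq0, ENNReal.toReal_ofReal (by linarith)]
    simp only [Real.norm_of_nonneg (hf _)]
  have h1 : (WithLp.toLp (ENNReal.ofReal q) (fun i => 𝔼 e, g e i) :
      PiLp (ENNReal.ofReal q) (fun _ : ι => ℝ)) =
      (Fintype.card Ω : ℝ)⁻¹ • ∑ e, WithLp.toLp (ENNReal.ofReal q) (g e) := by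
    ext i
    simp [Fintype.expect_eq_sum_div_card, div_eq_inv_mul]
  rw [← hnorm _ fun i => Finset.expect_nonneg fun e _ => hg e i, h1, norm_smul,
    Fintype.expect_eq_sum_div_card, div_eq_inv_mul, Real.norm_of_nonneg (by positivity)]
  refine mul_le_mul_of_nonneg_left ((norm_sum_le _ _).trans (le_of_eq ?_)) (by positivity)
  exact Finset.sum_congr rfl fun e _ => hnorm _ (hg e)

theorem sum_fin_succ {β M : Type*} [Fintype β] [AddCommMonoid M] {n : ℕ}
    (f : (Fin (n + 1) → β) → M) : ∑ i, f i = ∑ i : Fin n → β, ∑ a, f (Fin.cons a i) := by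
  rw [Finset.sum_comm, ← Finset.sum_product', Finset.univ_product_univ]
  exact (Fintype.sum_equiv (Fin.consEquiv fun _ => β) _ _ fun _ => rfl).symm

section Cotype

variable {Y : Type*} [NormedAddCommGroup Y]

/-- Cotype with first moments of the Rademacher sums. -/
theorem HasCotype.exists_le_expect [NormedSpace ℂ Y] {q : ℝ≥0∞} (hY : HasCotype Y q) :
    ∃ C : ℝ, 0 < C ∧ ∀ (N : ℕ) (x : Fin N → Y),
      finNorm q x ≤ C * 𝔼 e : Fin N → ℤˣ, ‖∑ k, e k • x k‖ := by
  obtain ⟨C, hC, h⟩ := hY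
  let _ : NormedSpace ℝ Y := NormedSpace.restrictScalars ℝ ℂ Y
  refine ⟨C * Real.sqrt 2, by positivity, fun N x => (h N x).trans ?_⟩
  have h1 := integral_norm_rademacher 0 x
  simp only [zero_add] at h1
  rw [h1, mul_assoc]
  refine mul_le_mul_of_nonneg_left ?_ hC.le
  have h2 : 0 ≤ 𝔼 e : Fin N → ℤˣ, ‖∑ k, e k • x k‖ :=
    Finset.expect_nonneg fun e _ => norm_nonneg _
  refine (Real.sqrt_le_sqrt (expect_norm_sq_le x)).trans ?_
  rw [Real.sqrt_mul (by norm_num), Real.sqrt_sq h2]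

/-- A cotype inequality for families indexed by `Fin N` iterates to families indexed by
`Fin m → Fin N`. -/
theorem rpow_sum_le_expect_multi {N : ℕ} {q A : ℝ} (hq : 1 ≤ q) (hA : 0 ≤ A)
    (h : ∀ y : Fin N → Y, (∑ a, ‖y a‖ ^ q) ^ (1 / q) ≤ A * 𝔼 e : Fin N → ℤˣ, ‖∑ a, e a • y a‖)
    (m : ℕ) (y : (Fin m → Fin N) → Y) :
    (∑ i, ‖y i‖ ^ q) ^ (1 / q) ≤
      A ^ m * 𝔼 e : Fin m → Fin N → ℤˣ, ‖∑ i, (∏ j, e j (i j)) • y i‖ := by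
  have hq0 : 0 < q := by linarith
  induction m with
  | zero =>
    simp only [Fintype.sum_unique, pow_zero, one_mul, Finset.univ_eq_empty, Finset.prod_empty,
      one_smul, Fintype.expect_const]
    rw [← Real.rpow_mul (norm_nonneg _), mul_one_div_cancel hq0.ne', Real.rpow_one]
  | succ m ih =>
    have h1 : ∀ i : Fin m → Fin N, ∑ a, ‖y (Fin.cons a i)‖ ^ q ≤
        (A * 𝔼 e : Fin N → ℤˣ, ‖∑ a, e a • y (Fin.cons a i)‖) ^ q := by
      intro i
      have h2 : 0 ≤ ∑ a, ‖y (Fin.cons a i)‖ ^ q := Finset.sum_nonneg fun a _ => by positivity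
      have h3 := Real.rpow_le_rpow (by positivity) (h fun a => y (Fin.cons a i)) hq0.le
      rwa [← Real.rpow_mul h2, one_div_mul_cancel hq0.ne', Real.rpow_one] at h3
    have hE : ∀ i : Fin m → Fin N, 0 ≤ 𝔼 e : Fin N → ℤˣ, ‖∑ a, e a • y (Fin.cons a i)‖ :=
      fun i => Finset.expect_nonneg fun e _ => norm_nonneg _
    have hES : 0 ≤ ∑ i : Fin m → Fin N, (𝔼 e : Fin N → ℤˣ, ‖∑ a, e a • y (Fin.cons a i)‖) ^ q :=
      Finset.sum_nonneg fun i _ => Real.rpow_nonneg (hE i) _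
    calc (∑ i, ‖y i‖ ^ q) ^ (1 / q)
        ≤ (∑ i : Fin m → Fin N,
            (A * 𝔼 e : Fin N → ℤˣ, ‖∑ a, e a • y (Fin.cons a i)‖) ^ q) ^ (1 / q) := by
          rw [sum_fin_succ]
          refine Real.rpow_le_rpow (Finset.sum_nonneg fun i _ => Finset.sum_nonneg fun a _ => ?_)
            (Finset.sum_le_sum fun i _ => h1 i) (by positivity)
          positivity
      _ = A * (∑ i : Fin m → Fin N,
            (𝔼 e : Fin N → ℤˣ, ‖∑ a, e a • y (Fin.cons a i)‖) ^ q) ^ (1 / q) := by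
          simp only [Real.mul_rpow hA (hE _), ← Finset.mul_sum]
          rw [Real.mul_rpow (Real.rpow_nonneg hA _) hES, ← Real.rpow_mul hA,
            mul_one_div_cancel hq0.ne', Real.rpow_one]
      -- Minkowski exchanges the `ℓ_q`-norm with the mean; first moments make this possible for
      -- every `q ≥ 1`.
      _ ≤ A * 𝔼 e : Fin N → ℤˣ, (∑ i : Fin m → Fin N,
            ‖∑ a, e a • y (Fin.cons a i)‖ ^ q) ^ (1 / q) :=
          mul_le_mul_of_nonneg_left (rpow_sum_expect_le hq fun e i => norm_nonneg _) hA
      _ ≤ A * 𝔼 e : Fin N → ℤˣ, A ^ m * 𝔼 e' : Fin m → Fin N → ℤˣ,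
            ‖∑ i : Fin m → Fin N, (∏ j, e' j (i j)) • ∑ a, e a • y (Fin.cons a i)‖ :=
          mul_le_mul_of_nonneg_left (Finset.expect_le_expect fun e _ => ih _) hA
      _ = _ := by
          rw [← Finset.mul_expect, ← mul_assoc, ← pow_succ', expect_fin_succ]
          congr 1
          refine Finset.expect_congr rfl fun e _ => Finset.expect_congr rfl fun e' _ => ?_
          rw [sum_fin_succ]
          congr 1
          refine Finset.sum_congr rfl fun i _ => ?_
          rw [Finset.smul_sum]
          refine Finset.sum_congr rfl fun a _ => ?_
          rw [Fin.prod_univ_succ, smul_smul, mul_comm]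
          simp

end Cotype

/-! ### Weighted mixed norms of the coefficients. -/

section Coefficients

variable {X Y : Type*} [NormedAddCommGroup X] [NormedSpace ℂ X]
  [NormedAddCommGroup Y] [NormedSpace ℂ Y]

theorem map_sum_single_eq {m N : ℕ} {p : Fin m → ℝ≥0∞} [∀ j, Fact (1 ≤ p j)]
    (T : ContinuousMultilinearMap ℂ (fun j => SeqSpace (p j)) X) (u : Fin m → Fin N → ℂ) :
    T (fun j => ∑ b, lp.single (p j) b.val (u j b)) =
      ∑ i : Fin m → Fin N, (∏ j, u j (i j)) • coefficient T (fun j => (i j).val) := by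
  rw [T.map_sum]
  refine Finset.sum_congr rfl fun i _ => ?_
  rw [coefficient, ← T.map_smul_univ]
  congr 1
  funext j
  rw [← lp.single_smul, smul_eq_mul, mul_one]

/-- For fixed coefficients in the unit balls, an `(r, 1)`-summing operator maps the slices of a
multilinear mapping to an `r`-summable family. -/
theorem finNorm_slice_le {r : ℝ≥0∞} {v : X →L[ℂ] Y} {C : ℝ} (hC : 0 ≤ C)
    (hv : ∀ (N : ℕ) (x : Fin N → X), finNorm r (fun k => v (x k)) ≤
      C * ⨆ φ : Metric.closedBall (0 : X →L[ℂ] ℂ) 1, finNorm 1 (fun k => φ.1 (x k)))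
    {m N : ℕ} {p : Fin m → ℝ≥0∞} [∀ j, Fact (1 ≤ p j)]
    (T : ContinuousMultilinearMap ℂ (fun j => SeqSpace (p j)) X) {w : Fin m → Fin N → ℝ}
    (hw : ∀ j (u : Fin N → ℂ), (∀ b, ‖u b‖ ≤ w j b) →
      ‖∑ b, lp.single (E := fun _ : ℕ => ℂ) (p j) b.val (u b)‖ ≤ 1)
    {u : Fin m → Fin N → ℂ} (hu : ∀ j b, ‖u j b‖ ≤ w j b) (k : Fin m) :
    finNorm r (fun a => v (∑ i : Fin m → Fin N with i k = a,
      (∏ j, u j (i j)) • coefficient T (fun j => (i j).val))) ≤ C * ‖T‖ := by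
  refine (hv N _).trans (mul_le_mul_of_nonneg_left ?_ hC)
  have : Nonempty (Metric.closedBall (0 : X →L[ℂ] ℂ) 1) := ⟨⟨0, by simp⟩⟩
  refine ciSup_le fun φ => ?_
  set S : Fin N → X := fun a => ∑ i : Fin m → Fin N with i k = a,
    (∏ j, u j (i j)) • coefficient T (fun j => (i j).val) with hS
  have hφ : ‖φ.1‖ ≤ 1 := mem_closedBall_zero_iff.1 φ.2
  -- The unimodular factors `ω a` are absorbed into the k-th argument of `T`, so that the sum of `|φ
  -- (S a)|` becomes a single value `φ (T ξ)`.
  choose ω hω1 hω using fun a => RCLike.exists_norm_eq_mul_self (K := ℂ) (φ.1 (S a))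
  set W : Fin m → Fin N → ℂ := fun j b => u j b * if j = k then ω b else 1 with hW
  have hWu : ∀ j b, ‖W j b‖ ≤ w j b := by
    intro j b
    rw [hW]
    dsimp only
    split_ifs
    · rw [norm_mul, hω1, mul_one]
      exact hu j b
    · rw [mul_one]
      exact hu j b
  set ξ : ∀ j, SeqSpace (p j) := fun j => ∑ b, lp.single (p j) b.val (W j b) with hξ
  have hT : T ξ = ∑ a, ω a • S a := by
    rw [hξ, map_sum_single_eq, ← Finset.sum_fiberwise Finset.univ (fun i : Fin m → Fin N => i k)]
    refine Finset.sum_congr rfl fun a _ => ?_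
    rw [hS, Finset.smul_sum]
    refine Finset.sum_congr rfl fun i hi => ?_
    rw [smul_smul, ← (Finset.mem_filter.1 hi).2, mul_comm (ω _)]
    simp only [hW, Finset.prod_mul_distrib, Finset.prod_ite_eq', Finset.mem_univ, if_true]
  have hsum : ((∑ a, ‖φ.1 (S a)‖ : ℝ) : ℂ) = φ.1 (T ξ) := by
    rw [hT, map_sum, Complex.ofReal_sum]
    refine Finset.sum_congr rfl fun a _ => ?_
    rw [map_smul, smul_eq_mul]
    exact hω a
  rw [finNorm_eq_sum (by simp)]
  simp only [ENNReal.toReal_one, Real.rpow_one, div_one]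
  calc ∑ a, ‖φ.1 (S a)‖ = ‖φ.1 (T ξ)‖ := by
        rw [← hsum, Complex.norm_real, Real.norm_of_nonneg (Finset.sum_nonneg fun a _ =>
          norm_nonneg _)]
    _ ≤ 1 * ‖T ξ‖ := φ.1.le_of_opNorm_le hφ _
    _ ≤ ‖T‖ * ∏ j, ‖ξ j‖ := by
        rw [one_mul]
        exact T.le_opNorm ξ
    _ ≤ ‖T‖ := mul_le_of_le_one_right (norm_nonneg _)
        (Finset.prod_le_one (fun j _ => norm_nonneg _) fun j _ => hw j _ (hWu j))

/-- The weighted mixed norms of the image of the coefficients. -/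
theorem weighted_mixed_le {r : ℝ≥0∞} (hr : 1 ≤ r) (hr' : r ≠ ∞) {v : X →L[ℂ] Y} {C : ℝ} (hC : 0 ≤ C)
    (hv : ∀ (N : ℕ) (x : Fin N → X), finNorm r (fun k => v (x k)) ≤
      C * ⨆ φ : Metric.closedBall (0 : X →L[ℂ] ℂ) 1, finNorm 1 (fun k => φ.1 (x k)))
    {m N : ℕ} {q A : ℝ} (hq : 1 ≤ q) (hA : 0 ≤ A)
    (h : ∀ y : Fin N → Y, (∑ a, ‖y a‖ ^ q) ^ (1 / q) ≤ A * 𝔼 e : Fin N → ℤˣ, ‖∑ a, e a • y a‖)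
    {p : Fin m → ℝ≥0∞} [∀ j, Fact (1 ≤ p j)]
    (T : ContinuousMultilinearMap ℂ (fun j => SeqSpace (p j)) X) {w : Fin m → Fin N → ℝ}
    (hw0 : ∀ j b, 0 ≤ w j b)
    (hw : ∀ j (u : Fin N → ℂ), (∀ b, ‖u b‖ ≤ w j b) →
      ‖∑ b, lp.single (E := fun _ : ℕ => ℂ) (p j) b.val (u b)‖ ≤ 1) (k : Fin m) :
    ∑ a, fiberSum (fun i : Fin m → Fin N => i k)
      (fun i => (‖v (coefficient T fun j => (i j).val)‖ * ∏ j, w j (i j)) ^ q) a ^ (r.toReal / q) ≤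
      (A ^ m * (C * ‖T‖)) ^ r.toReal := by
  have hr1 : 1 ≤ r.toReal := by
    rwa [← ENNReal.toReal_one, ENNReal.toReal_le_toReal ENNReal.one_ne_top hr']
  have hr0 : 0 < r.toReal := by linarith
  have hq0 : 0 < q := by linarith
  set c : (Fin m → Fin N) → X := fun i => coefficient T fun j => (i j).val with hc
  set G : (Fin m → Fin N → ℤˣ) → Fin N → ℝ := fun e a =>
    ‖v (∑ i : Fin m → Fin N with i k = a,
      (∏ j, (((e j (i j) : ℤ) : ℂ) * (w j (i j) : ℂ))) • c i)‖ with hG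
  have hGr : ∀ e, (∑ a, G e a ^ r.toReal) ^ (1 / r.toReal) ≤ C * ‖T‖ := by
    intro e
    have := finNorm_slice_le hC hv T hw (u := fun j b => ((e j b : ℤ) : ℂ) * (w j b : ℂ)) ?_ k
    · rwa [finNorm_eq_sum hr0] at this
    · intro j b
      rw [norm_mul, Complex.norm_real, Real.norm_of_nonneg (hw0 j b)]
      rcases Int.units_eq_one_or (e j b) with h1 | h1 <;> simp [h1]
  have hfib : ∀ a, fiberSum (fun i : Fin m → Fin N => i k)
      (fun i => (‖v (c i)‖ * ∏ j, w j (i j)) ^ q) a ^ (1 / q) ≤ A ^ m * 𝔼 e, G e a := by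
    intro a
    -- Extending the fibre by zero lets all m coordinates be randomised, so the same signs serve
    -- every `a`; the cost is the constant `A ^ m`.
    have := rpow_sum_le_expect_multi hq hA h m
      (fun i => if i k = a then ((∏ j, w j (i j) : ℝ) : ℂ) • v (c i) else 0)
    refine le_trans (le_of_eq ?_) (this.trans (le_of_eq ?_))
    · congr 1
      rw [fiberSum, Finset.sum_filter]
      refine Finset.sum_congr rfl fun i _ => ?_
      split_ifs
      · rw [norm_smul, Complex.norm_real, Real.norm_of_nonneg
          (Finset.prod_nonneg fun j _ => hw0 _ _), mul_comm]
      · rw [norm_zero, Real.zero_rpow hq0.ne']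
    · congr 1
      refine Finset.expect_congr rfl fun e _ => ?_
      rw [hG]
      dsimp only
      rw [Finset.sum_filter, map_sum]
      congr 1
      refine Finset.sum_congr rfl fun i _ => ?_
      split_ifs
      · rw [map_smul, Finset.prod_mul_distrib, mul_smul, Units.smul_def, ← Int.cast_smul_eq_zsmul ℂ]
        simp
      · simp
  have hE : ∀ a, 0 ≤ 𝔼 e, G e a := fun a => Finset.expect_nonneg fun e _ => norm_nonneg _
  have hF0 : ∀ a, 0 ≤ fiberSum (fun i : Fin m → Fin N => i k)
      (fun i => (‖v (c i)‖ * ∏ j, w j (i j)) ^ q) a := fun a => fiberSum_nonneg (fun i =>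
        Real.rpow_nonneg (mul_nonneg (norm_nonneg _) (Finset.prod_nonneg fun j _ => hw0 _ _)) _) a
  -- Minkowski in `ℓ_r`, then the bound `hGr` for each choice of signs.
  have hmink : ∑ a, (𝔼 e, G e a) ^ r.toReal ≤ (C * ‖T‖) ^ r.toReal := by
    have h1 := (rpow_sum_expect_le (g := G) hr1 fun e a => norm_nonneg _).trans
      (Finset.expect_le Finset.univ_nonempty fun e _ => hGr e)
    have h2 : 0 ≤ ∑ a, (𝔼 e, G e a) ^ r.toReal :=
      Finset.sum_nonneg fun a _ => Real.rpow_nonneg (hE a) _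
    have h3 := Real.rpow_le_rpow (by positivity) h1 hr0.le
    rwa [← Real.rpow_mul h2, one_div_mul_cancel hr0.ne', Real.rpow_one] at h3
  calc _ ≤ ∑ a, (A ^ m * 𝔼 e, G e a) ^ r.toReal := by
        refine Finset.sum_le_sum fun a _ => ?_
        have := Real.rpow_le_rpow (Real.rpow_nonneg (hF0 a) _) (hfib a) hr0.le
        rwa [← Real.rpow_mul (hF0 a), one_div_mul_eq_div] at this
    _ = (A ^ m) ^ r.toReal * ∑ a, (𝔼 e, G e a) ^ r.toReal := by
        rw [Finset.mul_sum]
        exact Finset.sum_congr rfl fun a _ => Real.mul_rpow (by positivity) (hE a)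
    _ ≤ _ := by
        rw [Real.mul_rpow (by positivity) (by positivity)]
        exact mul_le_mul_of_nonneg_left hmink (by positivity)

end Coefficients

/-! ### Comparison of finite norms, and passages to the limit. -/

theorem finNorm_top_apply_le {E : Type*} [NormedAddCommGroup E] {N : ℕ} (x : Fin N → E)
    (k : Fin N) : ‖x k‖ ≤ finNorm ∞ x :=
  PiLp.norm_apply_le (WithLp.toLp ∞ x : PiLp ∞ (fun _ : Fin N => E)) k

/-- A substitute for finite cotype when `q = ∞`: the factor tends to one as `t` grows. The base `N +
1` stays positive even for `N = 0`. -/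
theorem rpow_sum_le_card_rpow_mul_finNorm_top {E : Type*} [NormedAddCommGroup E] {N : ℕ}
    (x : Fin N → E) {t : ℝ} (ht : 0 < t) :
    (∑ k, ‖x k‖ ^ t) ^ (1 / t) ≤ (N + 1 : ℝ) ^ (1 / t) * finNorm ∞ x := by
  have h0 : 0 ≤ finNorm ∞ x := norm_nonneg _
  have h1 : ∑ k, ‖x k‖ ^ t ≤ (N + 1) * finNorm ∞ x ^ t := by
    calc ∑ k, ‖x k‖ ^ t ≤ ∑ _k : Fin N, finNorm ∞ x ^ t := Finset.sum_le_sum fun k _ =>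
          Real.rpow_le_rpow (norm_nonneg _) (finNorm_top_apply_le x k) ht.le
      _ = N * finNorm ∞ x ^ t := by simp
      _ ≤ _ := mul_le_mul_of_nonneg_right (by linarith) (Real.rpow_nonneg h0 _)
  refine (Real.rpow_le_rpow (Finset.sum_nonneg fun k _ => by positivity) h1
    (by positivity)).trans ?_
  rw [Real.mul_rpow (by positivity) (by positivity), ← Real.rpow_mul h0,
    mul_one_div_cancel ht.ne', Real.rpow_one]

theorem rpow_sum_le_finNorm {E : Type*} [NormedAddCommGroup E] {N : ℕ} (x : Fin N → E) {q : ℝ≥0∞}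
    (hq : 0 < q.toReal) {t : ℝ} (ht : q.toReal ≤ t) :
    (∑ k, ‖x k‖ ^ t) ^ (1 / t) ≤ finNorm q x := by
  have ht0 : 0 < t := hq.trans_le ht
  have h0 : 0 ≤ finNorm q x := by
    rw [finNorm_eq_sum hq]
    positivity
  have hS : 0 ≤ ∑ k, ‖x k‖ ^ q.toReal := Finset.sum_nonneg fun k _ => by positivity
  have hF : finNorm q x ^ q.toReal = ∑ k, ‖x k‖ ^ q.toReal := by
    rw [finNorm_eq_sum hq, ← Real.rpow_mul hS, one_div_mul_cancel hq.ne', Real.rpow_one]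
  have hk : ∀ k, ‖x k‖ ≤ finNorm q x := by
    intro k
    rw [← Real.rpow_le_rpow_iff (norm_nonneg _) h0 hq, hF]
    exact Finset.single_le_sum (f := fun k => ‖x k‖ ^ q.toReal) (fun j _ => by positivity)
      (Finset.mem_univ k)
  have h1 : ∑ k, ‖x k‖ ^ t ≤ finNorm q x ^ t := by
    have hsplit : t = (t - q.toReal) + q.toReal := by ring
    calc ∑ k, ‖x k‖ ^ t = ∑ k, ‖x k‖ ^ (t - q.toReal) * ‖x k‖ ^ q.toReal := by
          refine Finset.sum_congr rfl fun k _ => ?_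
          rw [← Real.rpow_add_of_nonneg (norm_nonneg _) (by linarith) hq.le, ← hsplit]
      _ ≤ ∑ k, finNorm q x ^ (t - q.toReal) * ‖x k‖ ^ q.toReal :=
          Finset.sum_le_sum fun k _ => mul_le_mul_of_nonneg_right
            (Real.rpow_le_rpow (norm_nonneg _) (hk k) (by linarith)) (by positivity)
      _ = finNorm q x ^ t := by
          rw [← Finset.mul_sum, ← hF, ← Real.rpow_add_of_nonneg h0 (by linarith) hq.le, ← hsplit]
  refine (Real.rpow_le_rpow (Finset.sum_nonneg fun k _ => by positivity) h1
    (by positivity)).trans (le_of_eq ?_)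
  rw [← Real.rpow_mul h0, mul_one_div_cancel ht0.ne', Real.rpow_one]

/-- Sequences dominated by `z ^ (1 / p)`, with `z` in the simplex, lie in the unit ball
of `ℓ_p`. -/
theorem norm_sum_single_le_one {p : ℝ≥0∞} [Fact (1 ≤ p)] {N : ℕ} {z : Fin N → ℝ}
    (hz : ∀ b, 0 ≤ z b) (hz1 : ∑ b, z b ≤ 1) {u : Fin N → ℂ}
    (hu : ∀ b, ‖u b‖ ≤ z b ^ (1 / p).toReal) :
    ‖∑ b, lp.single (E := fun _ : ℕ => ℂ) p b.val (u b)‖ ≤ 1 := by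
  have hp1 : 1 ≤ p := Fact.out
  rcases eq_or_ne p ∞ with rfl | hp
  -- For `p = ∞` the weight is `z ^ 0 = 1`, also where `z` vanishes.
  · simp only [ENNReal.div_top, ENNReal.toReal_zero, Real.rpow_zero] at hu
    refine lp.norm_le_of_forall_le zero_le_one fun n => ?_
    rw [lp.coeFn_sum, Finset.sum_apply]
    by_cases h : n < N
    · rw [Finset.sum_eq_single (⟨n, h⟩ : Fin N)]
      · rw [lp.single_apply_self]
        exact hu _
      · intro b _ hb
        exact lp.single_apply_ne _ _ _ fun h' => hb (Fin.ext h'.symm)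
      · simp
    · rw [Finset.sum_eq_zero]
      · simp
      · intro b _
        exact lp.single_apply_ne _ _ _ fun h' => h (h' ▸ b.2)
  · have hp0 : 0 < p.toReal := ENNReal.toReal_pos (zero_lt_one.trans_le hp1).ne' hp
    set f : ℕ → ℂ := fun n => if h : n < N then u ⟨n, h⟩ else 0 with hf
    have hfu : ∀ b : Fin N, f b.val = u b := fun b => by simp [hf]
    have h1 := lp.norm_sum_single (E := fun _ : ℕ => ℂ) hp0 f (Finset.range N)
    rw [Finset.sum_range, Finset.sum_range] at h1
    simp only [hfu] at h1
    rw [← Real.rpow_le_rpow_iff (norm_nonneg _) zero_le_one hp0, h1, Real.one_rpow]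
    refine le_trans (Finset.sum_le_sum fun b _ => ?_) hz1
    refine (Real.rpow_le_rpow (norm_nonneg _) (hu b) hp0.le).trans (le_of_eq ?_)
    rw [← Real.rpow_mul (hz b), ENNReal.toReal_div, ENNReal.toReal_one, one_div_mul_cancel hp0.ne',
      Real.rpow_one]

theorem sum_rpow_le_of_tendsto {ι : Type*} [Fintype ι] {b : ι → ℝ} {F : Filter ℝ} [F.NeBot]
    {μ K : ℝ → ℝ} {μ0 K0 : ℝ} (hμ0 : 0 < μ0) (hμ : Filter.Tendsto μ F (nhds μ0))
    (hK : Filter.Tendsto K F (nhds K0)) (h : ∀ᶠ u in F, ∑ i, b i ^ μ u ≤ K u ^ μ u) :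
    ∑ i, b i ^ μ0 ≤ K0 ^ μ0 :=
  le_of_tendsto_of_tendsto
    (tendsto_finsetSum _ fun _ _ => tendsto_const_nhds.rpow hμ (Or.inr hμ0))
    (hK.rpow hμ (Or.inr hμ0)) h

theorem rpow_tsum_enorm_le {E : Type*} [NormedAddCommGroup E] {m : ℕ} {y : (Fin m → ℕ) → E}
    {t K : ℝ} (ht : 0 < t) (hK : 0 ≤ K)
    (h : ∀ N : ℕ, ∑ i : Fin m → Fin N, ‖y fun j => (i j).val‖ ^ t ≤ K ^ t) :
    (∑' i, ‖y i‖ₑ ^ t) ^ (1 / t) ≤ ENNReal.ofReal K := by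
  have h1 : ∑' i, ‖y i‖ₑ ^ t ≤ ENNReal.ofReal K ^ t := by
    rw [ENNReal.tsum_eq_iSup_sum]
    refine iSup_le fun s => ?_
    -- A cube containing the finite index set `s`.
    set N : ℕ := (s.sup fun i => Finset.univ.sup i) + 1 with hN
    have hs : ∀ i ∈ s, ∀ j, i j < N := fun i hi j => Nat.lt_succ_of_le
      ((Finset.le_sup (f := i) (Finset.mem_univ j)).trans
        (Finset.le_sup (f := fun i : Fin m → ℕ => Finset.univ.sup i) hi))
    have hinj : Function.Injective fun (i : Fin m → Fin N) (j : Fin m) => (i j).val :=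
      fun i i' hii => funext fun j => Fin.ext (congrFun hii j)
    have hsub : s ⊆ Finset.univ.map ⟨_, hinj⟩ := fun i hi =>
      Finset.mem_map.2 ⟨fun j => ⟨i j, hs i hi j⟩, Finset.mem_univ _, rfl⟩
    refine (Finset.sum_le_sum_of_subset hsub).trans ?_
    rw [Finset.sum_map, ENNReal.ofReal_rpow_of_nonneg hK ht.le]
    refine le_trans (le_of_eq ?_) (ENNReal.ofReal_le_ofReal (h N))
    rw [ENNReal.ofReal_sum_of_nonneg fun i _ => by positivity]
    refine Finset.sum_congr rfl fun i _ => ?_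
    rw [← ENNReal.ofReal_rpow_of_nonneg (norm_nonneg _) ht.le, ofReal_norm]
    rfl
  refine (ENNReal.rpow_le_rpow h1 (by positivity)).trans (le_of_eq ?_)
  rw [← ENNReal.rpow_mul, mul_one_div_cancel ht.ne', ENNReal.rpow_one]

/-! ### The finite inequality and the theorem. -/

section

variable {X Y : Type*} [NormedAddCommGroup X] [NormedSpace ℂ X]
  [NormedAddCommGroup Y] [NormedSpace ℂ Y]

/-- The coefficient inequality for finitely many coefficients and a cotype exponent `q > l`. -/
theorem sum_coefficient_rpow_le {r : ℝ≥0∞} (hr : 1 ≤ r) (hr' : r ≠ ∞) {v : X →L[ℂ] Y} {C : ℝ}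
    (hC : 0 ≤ C)
    (hv : ∀ (N : ℕ) (x : Fin N → X), finNorm r (fun k => v (x k)) ≤
      C * ⨆ φ : Metric.closedBall (0 : X →L[ℂ] ℂ) 1, finNorm 1 (fun k => φ.1 (x k)))
    {m N : ℕ} (hm : 1 ≤ m) {l q A : ℝ} (hrl : r.toReal ≤ l) (hlq : l < q) (hA : 0 ≤ A)
    (h : ∀ y : Fin N → Y, (∑ a, ‖y a‖ ^ q) ^ (1 / q) ≤ A * 𝔼 e : Fin N → ℤˣ, ‖∑ a, e a • y a‖)
    {p : Fin m → ℝ≥0∞} [∀ j, Fact (1 ≤ p j)]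
    (hl : 1 / r.toReal = 1 / l + ∑ j, (1 / p j).toReal) {μ : ℝ} (hμ : 0 < μ)
    (hμl : 1 / μ = 1 / (m * l) + (m - 1) / (m * q))
    (T : ContinuousMultilinearMap ℂ (fun j => SeqSpace (p j)) X) :
    ∑ i : Fin m → Fin N, ‖v (coefficient T fun j => (i j).val)‖ ^ μ ≤
      (A ^ m * (C * ‖T‖)) ^ μ := by
  have hr1 : 1 ≤ r.toReal := by
    rwa [← ENNReal.toReal_one, ENNReal.toReal_le_toReal ENNReal.one_ne_top hr']
  have : Nonempty (Fin m) := ⟨⟨0, hm⟩⟩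
  refine sum_rpow_le_of_weighted_mixed (r := r.toReal) (l := l) (q := q)
    (s := fun j => (1 / p j).toReal) (fun i => norm_nonneg _) (by linarith) (by linarith) hlq hμ
    (by positivity) (fun j => ENNReal.toReal_nonneg) hl (by simpa using hμl) fun z hz hz1 k => ?_
  exact weighted_mixed_le hr hr' hC hv (by linarith) hA h T
    (w := fun j b => z j b ^ (1 / p j).toReal) (fun j b => Real.rpow_nonneg (hz j b) _)
    (fun j u hu => norm_sum_single_le_one (hz j) (hz1 j) hu) k

end

theorem theorem1p2 {X Y : Type*}
    [NormedAddCommGroup X] [NormedSpace ℂ X] [CompleteSpace X]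
    [NormedAddCommGroup Y] [NormedSpace ℂ Y] [CompleteSpace Y]
    (q r : ℝ≥0∞) (hY : HasCotype Y q) (hr : 1 ≤ r) (hrq : r ≤ q)
    (v : X →L[ℂ] Y) (hv : IsSumming r 1 v)
    (m : ℕ) (hm : 1 ≤ m) (p : Fin m → ℝ≥0∞) [∀ j, Fact (1 ≤ p j)]
    (hp : ∑ j, 1 / p j < 1 / r)
    (lam mu : ℝ≥0∞)
    (hlam : 1 / lam = 1 / r - ∑ j, 1 / p j)
    (hmu : 1 / mu = 1 / (m * lam) + (m - 1) / (m * q)) :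
    ∃ C : ℝ, 0 < C ∧
      ∀ T : ContinuousMultilinearMap ℂ (fun j => SeqSpace (p j)) X,
        (q ≤ lam →
          (∑' i : Fin m → ℕ, ‖v (coefficient T i)‖ₑ ^ lam.toReal) ^ (1 / lam.toReal)
            ≤ ENNReal.ofReal (C * ‖T‖)) ∧
        (lam < q →
          (∑' i : Fin m → ℕ, ‖v (coefficient T i)‖ₑ ^ mu.toReal) ^ (1 / mu.toReal)
            ≤ ENNReal.ofReal (C * ‖T‖)) := by
  obtain ⟨A, hA, hcot⟩ := hY.exists_le_expect
  obtain ⟨C, hC, hv⟩ := hv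
  have hr0 : r ≠ 0 := (zero_lt_one.trans_le hr).ne'
  have hr' : r ≠ ∞ := by
    rintro rfl
    simp at hp
  have hq0 : q ≠ 0 := (zero_lt_one.trans_le (hr.trans hrq)).ne'
  -- Subtraction here is truncated; `hp` makes it genuine.
  have hadd : 1 / r = 1 / lam + ∑ j, 1 / p j := by
    rw [hlam, tsub_add_cancel_of_le hp.le]
  have hrt : 1 / r ≠ ∞ := by simpa using hr0
  have hlam0 : lam ≠ 0 := by
    rintro rfl
    rw [hadd] at hrt
    simp at hrt
  have hlam' : lam ≠ ∞ := by
    rintro rfl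
    rw [ENNReal.div_top] at hlam
    exact absurd hlam.symm (tsub_pos_iff_lt.2 hp).ne'
  have hm0 : (m : ℝ≥0∞) ≠ 0 := by
    simp only [ne_eq, Nat.cast_eq_zero]
    omega
  have hmR : (1 : ℝ) ≤ m := by exact_mod_cast hm
  have hmR0 : (m : ℝ) ≠ 0 := by linarith
  have hl0 : 0 < lam.toReal := ENNReal.toReal_pos hlam0 hlam'
  have hrR : 0 < r.toReal := ENNReal.toReal_pos hr0 hr'
  have hl : 1 / r.toReal = 1 / lam.toReal + ∑ j, (1 / p j).toReal := by
    have hfin : ∑ j, 1 / p j ≠ ∞ := (hp.trans_le le_top).ne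
    have := congrArg ENNReal.toReal hadd
    rw [ENNReal.toReal_add (by simpa using hlam0) hfin,
      ENNReal.toReal_sum fun j hj => ((ENNReal.sum_ne_top.1 hfin) j hj)] at this
    simpa only [ENNReal.toReal_div, ENNReal.toReal_one] using this
  have hrl : r.toReal ≤ lam.toReal := by
    have h1 : 0 ≤ ∑ j, (1 / p j).toReal := Finset.sum_nonneg fun j _ => ENNReal.toReal_nonneg
    exact (one_div_le_one_div hl0 hrR).1 (by linarith)
  have hmuR : 1 / mu.toReal = 1 / (m * lam.toReal) + (m - 1) / (m * q.toReal) := by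
    have := congrArg ENNReal.toReal hmu
    rw [ENNReal.toReal_add (by simp [hm0, hlam0]) (ENNReal.div_ne_top (by simp) (by simp [hm0, hq0]))]
      at this
    have h1 : ((m : ℝ≥0∞) - 1).toReal = m - 1 := by
      rw [ENNReal.toReal_sub_of_le (by exact_mod_cast hm) (by simp)]
      simp
    simpa only [ENNReal.toReal_div, ENNReal.toReal_one, ENNReal.toReal_mul, ENNReal.toReal_natCast,
      h1] using this
  have hmu0 : 0 < mu.toReal := by
    rw [← one_div_pos, hmuR]
    have h1 : 0 ≤ ((m : ℝ) - 1) / (m * q.toReal) :=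
      div_nonneg (by linarith) (by positivity)
    have h2 : 0 < 1 / (m * lam.toReal) := by positivity
    linarith
  refine ⟨A ^ m * C, by positivity, fun T => ?_⟩
  -- `M u` is the exponent `μ` belonging to cotype exponent `1 / u`; it is continuous up to `u = 0`
  -- and equals `λ` at `u = 1 / λ`.
  set M : ℝ → ℝ := fun u => 1 / (1 / (m * lam.toReal) + (m - 1) / m * u) with hM
  have hden : ∀ u : ℝ, 0 ≤ u → 0 < 1 / (m * lam.toReal) + (m - 1) / m * u := by
    intro u hu
    have h1 : 0 ≤ ((m : ℝ) - 1) / m * u := mul_nonneg (div_nonneg (by linarith) (by linarith)) hu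
    have h2 : 0 < 1 / (m * lam.toReal) := by positivity
    linarith
  have hMpos : ∀ u : ℝ, 0 ≤ u → 0 < M u := fun u hu => one_div_pos.2 (hden u hu)
  have hMcont : ∀ u : ℝ, 0 ≤ u → ContinuousAt M u := fun u hu =>
    ContinuousAt.div continuousAt_const (by fun_prop) (hden u hu).ne'
  have hmain : ∀ (N : ℕ) (u B : ℝ), 0 < u → u < 1 / lam.toReal → 0 ≤ B →
      (∀ y : Fin N → Y, (∑ a, ‖y a‖ ^ (1 / u)) ^ (1 / (1 / u)) ≤
        B * 𝔼 e : Fin N → ℤˣ, ‖∑ a, e a • y a‖) →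
      ∑ i : Fin m → Fin N, ‖v (coefficient T fun j => (i j).val)‖ ^ M u ≤
        (B ^ m * (C * ‖T‖)) ^ M u := by
    intro N u B hu hul hB h
    refine sum_coefficient_rpow_le hr hr' hC.le hv hm hrl ((lt_one_div hl0 hu).2 hul) hB h hl
      (hMpos u hu.le) ?_ T
    rw [hM, one_div_one_div]
    field_simp
  constructor
  · intro hqlam
    have hq' : q ≠ ∞ := (hqlam.trans_lt hlam'.lt_top).ne
    have hqR : 0 < q.toReal := ENNReal.toReal_pos hq0 hq'
    have hqlR : q.toReal ≤ lam.toReal := ENNReal.toReal_mono hlam' hqlam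
    refine rpow_tsum_enorm_le hl0 (by positivity) fun N => ?_
    rw [mul_assoc]
    have hMl : M (1 / lam.toReal) = lam.toReal := by
      rw [hM]
      dsimp only
      rw [show 1 / (m * lam.toReal) + ((m : ℝ) - 1) / m * (1 / lam.toReal) = 1 / lam.toReal by
        field_simp; ring, one_div_one_div]
    -- The exponents `1 / u` exceed `λ ≥ q`, so the cotype constant `A` serves for all of them.
    refine sum_rpow_le_of_tendsto (F := nhdsWithin (1 / lam.toReal) (Set.Iio (1 / lam.toReal)))
      (μ := M) (K := fun _ => A ^ m * (C * ‖T‖)) hl0 ?_ tendsto_const_nhds ?_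
    · have := (hMcont (1 / lam.toReal) (by positivity)).tendsto
      rw [hMl] at this
      exact this.mono_left nhdsWithin_le_nhds
    · filter_upwards [Ioo_mem_nhdsLT (show 0 < 1 / lam.toReal by positivity)] with u hu
      refine hmain N u A hu.1 hu.2 hA.le fun y => (rpow_sum_le_finNorm y hqR ?_).trans (hcot N y)
      exact hqlR.trans ((le_one_div hl0 hu.1).2 hu.2.le)
  · intro hlamq
    refine rpow_tsum_enorm_le hmu0 (by positivity) fun N => ?_
    rw [mul_assoc]
    rcases eq_or_ne q ∞ with rfl | hq'
    · have hM0 : M 0 = mu.toReal := by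
        rw [← one_div_one_div mu.toReal, hmuR, hM]
        simp
      -- For fixed `N` the loss `(N + 1) ^ u` disappears as `u` tends to 0, leaving a constant
      -- independent of `N`.
      refine sum_rpow_le_of_tendsto (F := nhdsWithin 0 (Set.Ioi 0))
        (μ := M) (K := fun u => ((N + 1 : ℝ) ^ u * A) ^ m * (C * ‖T‖)) hmu0 ?_ ?_ ?_
      · rw [← hM0]
        exact (hMcont 0 le_rfl).tendsto.mono_left nhdsWithin_le_nhds
      · have hc : Continuous fun u : ℝ => ((N + 1 : ℝ) ^ u * A) ^ m * (C * ‖T‖) := by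
          have : Continuous fun u : ℝ => (N + 1 : ℝ) ^ u :=
            Real.continuous_const_rpow (by positivity)
          fun_prop
        have := (hc.tendsto 0).mono_left (nhdsWithin_le_nhds (s := Set.Ioi 0))
        simpa using this
      · filter_upwards [Ioo_mem_nhdsGT (show 0 < 1 / lam.toReal by positivity)] with u hu
        refine hmain N u _ hu.1 hu.2 (by positivity) fun y => ?_
        refine (rpow_sum_le_card_rpow_mul_finNorm_top y (one_div_pos.2 hu.1)).trans ?_
        rw [one_div_one_div, mul_assoc]
        exact mul_le_mul_of_nonneg_left (hcot N y) (by positivity)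
    · have hqR : 0 < q.toReal := ENNReal.toReal_pos hq0 hq'
      have hlq : lam.toReal < q.toReal := ENNReal.toReal_strict_mono hq' hlamq
      refine sum_coefficient_rpow_le hr hr' hC.le hv hm hrl hlq hA.le
        (fun y => (rpow_sum_le_finNorm y hqR le_rfl).trans (hcot N y)) hl hmu0 hmuR T
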